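/- **Setting.** Let $N\ge 2$, $n=\sum_{i=1}^N n_i$, $m=\sum_{i=1}^N m_i$, $m<n$ (with $m_i=0$ for an agent $i$ that maintains no dual variable). Let $A=[A_{ij}]\in\mathbb R^{m\times n}$, $A_{ij}\in\mathbb R^{m_i\times n_j}$, have full row rank, let $b=\mathrm{col}(b_i)\in\mathbb R^m$, and let $f_i:\mathbb R^{n_i}\to\mathbb R$ be twice continuously differentiable with $$\mu_i\|x-y\|^2\le\langle\nabla f_i(x)-\nabla f_i(y),x-y\rangle\le\ell_i\|x-y\|^2\quad\text{for all }x,y\in\mathbb R^{n_i},\qquad \mu_i>0 .$$ Let $(\bar x,\bar\lambda)$ satisfy the KKT conditions $\nabla f(\bar x)+A^\top\bar\lambda=0$, $A\bar x=b$ of the problem $\min_x f(x)=\sum_i f_i(x_i)$ subject to $Ax=b$. For each $i$ let $B_i(\hat x_i)$, $\hat x_i\in\mathbb R^{n_i}$, be symmetric matrices with $\mu_iI\preceq B_i(\hat x_i)\preceq\ell_iI$ and $\nabla f_i(\hat x_i)-\nabla f_i(\bar x_i)=B_i(\hat x_i)(\hat x_i-\bar x_i)$ (such matrices exist, e.g.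 the Hessian averaged over the segment from $\bar x_i$ to $\hat x_i$). Put $r_i=n_i+m_i$, $r=n+m$, $$A_i(\hat x_i)=\begin{bmatrix}-B_i(\hat x_i)&-A_{ii}^\top\\A_{ii}&0\end{bmatrix},\qquad \mathcal A(\hat x)=\mathrm{blkdiag}(A_i(\hat x_i))_{i},\qquad T_{ij}=\begin{bmatrix}0&-A_{ji}^\top\\A_{ij}&0\end{bmatrix},$$ number the pairs $(i,j)$ with $j\ne i$, $T_{ij}\ne0$ as $k=1,\dots,\rho$, and let $\mathcal T_k\in\mathbb R^{r\times r}$ have $(i,j)$-th block $T_{ij}$ and all other blocks zero. For a gain $\mathcal K\in\mathbb R^{r\times r}$ and delays $\tau_k:[0,\infty)\to[0,h_k]$, the error dynamics of the augmented primal-dual gradient dynamics is $$\dot{\tilde z}(t)=(\mathcal A(\hat x(t))+\mathcal K)\tilde z(t)+\sum_{k=1}^{\rho}\mathcal T_k\,\tilde z(t-\tau_k(t))-\mathcal K\tilde u(t),\qquad \dot{\tilde u}(t)=\tilde z(t)-\tilde u(t),$$ where $\tilde z=\mathrm{col}(\tilde z_i)$, $\tilde z_i=\mathrm{col}(\tilde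 x_i,\tilde\lambda_i)$, and $\hat x=\bar x+\tilde x$. **Matrix inequalities.** Let $h_k\ge0$, $d_k\in[0,1)$ and $\varepsilon>0$ be given. The unknowns are $r\times r$ matrices $Y_{11},Y_{12},Y_{22}$, symmetric $R_k>0$, $Q_k>0$, $S_k>0$, matrices $S_{12,k}$ ($k=1,\dots,\rho$), and block-diagonal $P_2=\mathrm{blkdiag}(P_{2,i})$, $X=\mathrm{blkdiag}(X_i)$ with $P_{2,i},X_i\in\mathbb R^{r_i\times r_i}$ and $P_{2,i}+P_{2,i}^\top>0$. With $R=\mathrm{blkdiag}(R_k)$, $S=\mathrm{blkdiag}(S_k)$, $S_{12}=\mathrm{blkdiag}(S_{12,k})$, the inequalities are $$\begin{bmatrix}R&S_{12}\\ *&R\end{bmatrix}\ge0,\qquad\begin{bmatrix}Y_{11}&Y_{12}\\ *&Y_{22}\end{bmatrix}>0,\qquad \Phi(\hat x)=\begin{bmatrix}\phi_{11}&\phi_{12}&\phi_{13}&0&0\\ *&\phi_{22}(\hat x)&\phi_{23}(\hat x)&\phi_{24}&\phi_{25}\\ *&*&\phi_{33}&0&\phi_{35}\\ *&*&*&\phi_{44}&\phi_{45}\\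 *&*&*&*&\phi_{55}\end{bmatrix}<0\ \text{ for all }\hat x\in\mathbb R^n,$$ where $*$ denotes symmetric completion and $\phi_{11}=-2Y_{22}$, $\phi_{12}=-Y_{12}^\top+Y_{22}-X^\top$, $\phi_{13}=Y_{12}^\top-\varepsilon X^\top$, $\phi_{22}(\hat x)=Y_{12}+Y_{12}^\top+P_2^\top\mathcal A(\hat x)+X+\mathcal A(\hat x)^\top P_2+X^\top+\sum_{k}(S_k+Q_k-R_k)$, $\phi_{23}(\hat x)=Y_{11}-P_2^\top+\varepsilon\mathcal A(\hat x)^\top P_2+\varepsilon X^\top$, $\phi_{24}=[S_{12,1},\dots,S_{12,\rho}]$, $\phi_{25}=[R_1-S_{12,1}+P_2^\top\mathcal T_1,\dots,R_\rho-S_{12,\rho}+P_2^\top\mathcal T_\rho]$, $\phi_{33}=-\varepsilon P_2-\varepsilon P_2^\top+\sum_k h_k^2R_k$, $\phi_{35}=[\varepsilon P_2^\top\mathcal T_1,\dots,\varepsilon P_2^\top\mathcal T_\rho]$, $\phi_{44}=-S-R$, $\phi_{45}=R-S_{12}^\top$, $\phi_{55}=-2R+S_{12}+S_{12}^\top-\mathrm{blkdiag}((1-d_k)Q_k)_k$.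 **Claim.** Suppose that these inequalities hold for some such matrices, and let $\mathcal K=(P_2^\top)^{-1}X$. Then the origin of the error dynamics is uniformly asymptotically stable for all differentiable delays with $\tau_k(t)\in[0,h_k]$ and $|\dot\tau_k(t)|\le d_k$ for all $k$ and all $t\ge0$. If the inequalities hold with $d_k=1$ for all $k$ (and $Q_k>0$), or with $Q_k=0$ for all $k$, then, with the same choice of $\mathcal K$, the origin is uniformly asymptotically stable for all (measurable) delays with $\tau_k(t)\in[0,h_k]$, without any restriction on $\dot\tau_k$. -/

import Mathlib

open scoped Matrix

noncomputable section

namespace DelayPDGD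

/-! ### The optimization problem

There are `N` agents. Agent `i` has a primal variable in `ℝ^(n i)` and a dual variable in
`ℝ^(m i)`; `m i = 0` for an agent that maintains no dual variable. -/

/-- Primal points `x = col(x_i)`, with the Euclidean norm on every block. -/
abbrev Primal {N : ℕ} (n : Fin N → ℕ) : Type := ∀ i, EuclideanSpace ℝ (Fin (n i))

/-- Index set of the local vector `z_i = col(x_i, λ_i) ∈ ℝ^(r_i)`, `r_i = n_i + m_i`. -/
abbrev LocalIdx {N : ℕ} (n m : Fin N → ℕ) (i : Fin N) : Type := Fin (n i) ⊕ Fin (m i)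

/-- Index set of the stacked vector `z = col(z_i) ∈ ℝ^r`, `r = n + m`. -/
abbrev Idx {N : ℕ} (n m : Fin N → ℕ) : Type := Σ i, LocalIdx n m i

/-- The space `ℝ^r` of the stacked vectors `z` (and `u`), with the Euclidean norm. -/
abbrev StateSpace {N : ℕ} (n m : Fin N → ℕ) : Type := EuclideanSpace ℝ (Idx n m)

/-- The blocks `A_ij ∈ ℝ^(m_i × n_j)` of the constraint matrix. -/
abbrev Blocks {N : ℕ} (n m : Fin N → ℕ) : Type := ∀ i j, Matrix (Fin (m i)) (Fin (n j)) ℝ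

/-- The cost `g` of one agent is twice continuously differentiable, `μ`-strongly convex with
`μ > 0`, and `ℓ`-smooth. -/
structure StronglyConvexSmooth {k : ℕ} (g : EuclideanSpace ℝ (Fin k) → ℝ) (μ ℓ : ℝ) : Prop where
  contDiff : ContDiff ℝ 2 g
  mu_pos : 0 < μ
  lower : ∀ x y, μ * ‖x - y‖ ^ 2 ≤ inner ℝ (gradient g x - gradient g y) (x - y)
  upper : ∀ x y, inner ℝ (gradient g x - gradient g y) (x - y) ≤ ℓ * ‖x - y‖ ^ 2

section Problem

variable {N : ℕ} {n m : Fin N → ℕ}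

/-- The full constraint matrix `A = [A_ij] ∈ ℝ^(m × n)`. -/
def fullMatrix (A : Blocks n m) : Matrix (Σ i, Fin (m i)) (Σ j, Fin (n j)) ℝ :=
  Matrix.of fun a c => A a.1 c.1 a.2 c.2

/-- The matrix `A = [A_ij]` has full row rank. -/
def FullRowRank (A : Blocks n m) : Prop := (fullMatrix A).rank = ∑ i, m i

/-- The pair `(x, lam)` satisfies the KKT conditions `∇f(x) + Aᵀ lam = 0`, `A x = b` of
`min ∑ f_i(x_i)` subject to `A x = b`, written block by block. -/
structure IsKKT (f : ∀ i, EuclideanSpace ℝ (Fin (n i)) → ℝ) (A : Blocks n m)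
    (b : ∀ i, Fin (m i) → ℝ) (x : Primal n) (lam : ∀ i, Fin (m i) → ℝ) : Prop where
  stationary : ∀ i, (gradient (f i) (x i)).ofLp + ∑ j, (A j i)ᵀ *ᵥ lam j = 0
  feasible : ∀ i, ∑ j, A i j *ᵥ (x j).ofLp = b i

end Problem

/-- `B` assigns to every point `x` a symmetric matrix with `μ I ≤ B(x) ≤ ℓ I` and
`∇g(x) - ∇g(x̄) = B(x) (x - x̄)`. -/
def IsSecantFamily {k : ℕ} (g : EuclideanSpace ℝ (Fin k) → ℝ) (μ ℓ : ℝ)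
    (xbar : EuclideanSpace ℝ (Fin k))
    (B : EuclideanSpace ℝ (Fin k) → Matrix (Fin k) (Fin k) ℝ) : Prop :=
  ∀ x, (B x).IsSymm ∧ (B x - μ • (1 : Matrix (Fin k) (Fin k) ℝ)).PosSemidef ∧
    (ℓ • (1 : Matrix (Fin k) (Fin k) ℝ) - B x).PosSemidef ∧
    (gradient g x - gradient g xbar).ofLp = B x *ᵥ (x - xbar).ofLp

/-- Every admissible cost has such a family: the Hessian averaged over the segment from `x̄`
to `x`. -/
theorem exists_isSecantFamily {k : ℕ} {g : EuclideanSpace ℝ (Fin k) → ℝ} {μ ℓ : ℝ}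
    (hg : StronglyConvexSmooth g μ ℓ) (xbar : EuclideanSpace ℝ (Fin k)) :
    ∃ B, IsSecantFamily g μ ℓ xbar B := by
  have hd1 : ContDiff ℝ 1 (fderiv ℝ g) := hg.contDiff.fderiv_right (by norm_num)
  let J := (InnerProductSpace.toDual ℝ (EuclideanSpace ℝ (Fin k))).symm
  have hgrad : gradient g = fun y => J (fderiv ℝ g y) := rfl
  have hinner : ∀ y v, inner ℝ (gradient g y) v = fderiv ℝ g y v := by
    intro y v
    rw [hgrad]
    exact InnerProductSpace.toDual_symm_apply
  have hdd : ∀ y, HasFDerivAt (fderiv ℝ g) (fderiv ℝ (fderiv ℝ g) y) y := fun y =>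
    (hd1.differentiable (by norm_num) y).hasFDerivAt
  have hcont : Continuous (fderiv ℝ (fderiv ℝ g)) := hd1.continuous_fderiv (by norm_num)
  have hsymm : ∀ y v w, fderiv ℝ (fderiv ℝ g) y v w = fderiv ℝ (fderiv ℝ g) y w v := by
    intro y v w
    have : IsSymmSndFDerivAt ℝ g y :=
      (hg.contDiff.contDiffAt).isSymmSndFDerivAt (by simp)
    exact this v w
  have hline : ∀ y v w (t : ℝ), HasDerivAt (fun t : ℝ => fderiv ℝ g (y + t • v) w)
      (fderiv ℝ (fderiv ℝ g) (y + t • v) v w) t := by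
    intro y v w t
    have h1 : HasDerivAt (fun t : ℝ => y + t • v) v t := by
      simpa using ((hasDerivAt_id t).smul_const v).const_add y
    have h2 := (hdd (y + t • v)).comp_hasDerivAt t h1
    exact ((ContinuousLinearMap.apply ℝ ℝ w).hasFDerivAt.comp_hasDerivAt t h2)
  have hslope : ∀ y v, Filter.Tendsto
      (fun t : ℝ => t⁻¹ * (fderiv ℝ g (y + t • v) v - fderiv ℝ g y v)) (nhdsWithin 0 {0}ᶜ)
      (nhds (fderiv ℝ (fderiv ℝ g) y v v)) := by
    intro y v
    have h := (hline y v v 0).tendsto_slope_zero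
    simpa using h
  have hkey : ∀ y v (t : ℝ), inner ℝ (gradient g (y + t • v) - gradient g y) (y + t • v - y)
      = t * (fderiv ℝ g (y + t • v) v - fderiv ℝ g y v) := by
    intro y v t
    rw [add_sub_cancel_left, inner_smul_right, inner_sub_left, hinner, hinner]
  have hnorm : ∀ (y v : EuclideanSpace ℝ (Fin k)) (t : ℝ),
      ‖y + t • v - y‖ ^ 2 = t ^ 2 * ‖v‖ ^ 2 := by
    intro y v t
    rw [add_sub_cancel_left, norm_smul, mul_pow, Real.norm_eq_abs, sq_abs]
  have hlo : ∀ y v, μ * ‖v‖ ^ 2 ≤ fderiv ℝ (fderiv ℝ g) y v v := by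
    intro y v
    refine ge_of_tendsto (hslope y v) ?_
    filter_upwards [self_mem_nhdsWithin] with t ht
    have ht' : t ≠ 0 := ht
    have h := hg.lower (y + t • v) y
    rw [hkey, hnorm] at h
    have : 0 < t ^ 2 := by positivity
    refine le_of_mul_le_mul_left ?_ this
    calc t ^ 2 * (μ * ‖v‖ ^ 2) = μ * (t ^ 2 * ‖v‖ ^ 2) := by ring
      _ ≤ _ := h
      _ = _ := by field_simp
  have hup : ∀ y v, fderiv ℝ (fderiv ℝ g) y v v ≤ ℓ * ‖v‖ ^ 2 := by
    intro y v
    refine le_of_tendsto (hslope y v) ?_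
    filter_upwards [self_mem_nhdsWithin] with t ht
    have ht' : t ≠ 0 := ht
    have h := hg.upper (y + t • v) y
    rw [hkey, hnorm] at h
    have : 0 < t ^ 2 := by positivity
    refine le_of_mul_le_mul_left ?_ this
    calc _ = t * (fderiv ℝ g (y + t • v) v - fderiv ℝ g y v) := by field_simp
      _ ≤ _ := h
      _ = _ := by ring
  let e : Fin k → EuclideanSpace ℝ (Fin k) := fun i => EuclideanSpace.single i 1
  have hsum : ∀ v : EuclideanSpace ℝ (Fin k), v = ∑ i, v i • e i := by
    intro v
    ext j
    simp [e, Finset.sum_apply, Pi.single_apply]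
  let H : EuclideanSpace ℝ (Fin k) → ℝ →
      EuclideanSpace ℝ (Fin k) →L[ℝ] EuclideanSpace ℝ (Fin k) →L[ℝ] ℝ :=
    fun x s => fderiv ℝ (fderiv ℝ g) (xbar + s • (x - xbar))
  have hHc : ∀ x v w, Continuous fun s => H x s v w := by
    intro x v w
    have : Continuous (H x) := hcont.comp (by fun_prop)
    fun_prop
  have hbil : ∀ x (v w : EuclideanSpace ℝ (Fin k)),
      ∑ i, ∑ j, v i * ((∫ s in (0 : ℝ)..1, H x s (e i) (e j)) * w j) =
        ∫ s in (0 : ℝ)..1, H x s v w := by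
    intro x v w
    have h1 : ∀ s, H x s v w = ∑ i, ∑ j, v i * (H x s (e i) (e j) * w j) := by
      intro s
      conv_lhs => rw [hsum v, hsum w]
      simp only [map_sum, map_smul, _root_.sum_apply,
        _root_.smul_apply, smul_eq_mul]
      simp only [Finset.mul_sum]
      rw [Finset.sum_comm]
      refine Finset.sum_congr rfl fun i _ => ?_
      refine Finset.sum_congr rfl fun j _ => ?_
      ring
    simp only [h1]
    rw [intervalIntegral.integral_finsetSum]
    · refine Finset.sum_congr rfl fun i _ => ?_
      rw [intervalIntegral.integral_finsetSum]
      · refine Finset.sum_congr rfl fun j _ => ?_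
        rw [intervalIntegral.integral_const_mul, intervalIntegral.integral_mul_const]
      · intro j _
        have := hHc x (e i) (e j)
        exact Continuous.intervalIntegrable (by fun_prop) _ _
    · intro i _
      have := fun j => hHc x (e i) (e j)
      exact Continuous.intervalIntegrable (by fun_prop) _ _
  let B : EuclideanSpace ℝ (Fin k) → Matrix (Fin k) (Fin k) ℝ := fun x =>
    Matrix.of fun i j => ∫ s in (0 : ℝ)..1, H x s (e i) (e j)
  have hBs : ∀ x, (B x).IsSymm := by
    intro x
    ext i j
    simp only [Matrix.transpose_apply, B, Matrix.of_apply]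
    exact congrArg (fun F : ℝ → ℝ => ∫ s in (0 : ℝ)..1, F s)
      (funext fun s => hsymm _ _ _)
  have hBq : ∀ x (v w : Fin k → ℝ), v ⬝ᵥ (B x *ᵥ w) =
      ∫ s in (0 : ℝ)..1, H x s (WithLp.toLp 2 v) (WithLp.toLp 2 w) := by
    intro x v w
    rw [← hbil]
    simp [dotProduct, Matrix.mulVec, B, Finset.mul_sum]
  have hn : ∀ v : Fin k → ℝ, v ⬝ᵥ v = ‖(WithLp.toLp 2 v : EuclideanSpace ℝ (Fin k))‖ ^ 2 := by
    intro v
    rw [EuclideanSpace.norm_sq_eq]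
    simp [dotProduct, sq]
  refine ⟨B, fun x => ⟨hBs x, ?_, ?_, ?_⟩⟩
  · refine Matrix.PosSemidef.of_dotProduct_mulVec_nonneg ?_ ?_
    · ext i j
      simp [Matrix.sub_apply, Matrix.one_apply, (hBs x).apply, eq_comm]
    · intro v
      rw [star_trivial, Matrix.sub_mulVec, dotProduct_sub, hBq, Matrix.smul_mulVec,
        Matrix.one_mulVec, dotProduct_smul, hn, smul_eq_mul, sub_nonneg]
      calc _ = ∫ s in (0 : ℝ)..1, μ * ‖(WithLp.toLp 2 v : EuclideanSpace ℝ (Fin k))‖ ^ 2 := by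
            simp
        _ ≤ _ := intervalIntegral.integral_mono_on zero_le_one (by simp)
            ((hHc x _ _).intervalIntegrable _ _) fun s _ => hlo _ _
  · refine Matrix.PosSemidef.of_dotProduct_mulVec_nonneg ?_ ?_
    · ext i j
      simp [Matrix.sub_apply, Matrix.one_apply, (hBs x).apply, eq_comm]
    · intro v
      rw [star_trivial, Matrix.sub_mulVec, dotProduct_sub, hBq, Matrix.smul_mulVec,
        Matrix.one_mulVec, dotProduct_smul, hn, smul_eq_mul, sub_nonneg]
      calc _ ≤ ∫ s in (0 : ℝ)..1, ℓ * ‖(WithLp.toLp 2 v : EuclideanSpace ℝ (Fin k))‖ ^ 2 :=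
            intervalIntegral.integral_mono_on zero_le_one
              ((hHc x _ _).intervalIntegrable _ _) (by simp) fun s _ => hup _ _
        _ = _ := by simp
  · have hft : ∀ w, ∫ s in (0 : ℝ)..1, H x s (x - xbar) w =
        fderiv ℝ g x w - fderiv ℝ g xbar w := by
      intro w
      rw [intervalIntegral.integral_eq_sub_of_hasDerivAt
        (f := fun t : ℝ => fderiv ℝ g (xbar + t • (x - xbar)) w)
        (fun t _ => hline xbar (x - xbar) w t) ((hHc x _ _).intervalIntegrable _ _)]
      simp
    refine dotProduct_eq _ _ fun w => ?_
    have h1 : (gradient g x - gradient g xbar).ofLp ⬝ᵥ w =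
        inner ℝ (gradient g x - gradient g xbar) (WithLp.toLp 2 w) := by
      simp [PiLp.inner_apply, dotProduct, mul_comm]
    rw [h1, inner_sub_left, hinner, hinner, ← hft, dotProduct_comm, hBq]
    refine congrArg (fun F : ℝ → ℝ => ∫ s in (0 : ℝ)..1, F s) (funext fun s => ?_)
    exact (hsymm _ _ _).trans rfl

section Matrices

variable {N : ℕ} {n m : Fin N → ℕ}

/-- `A_i(x_i) = [-B_i(x_i), -A_iiᵀ; A_ii, 0]`. -/
def localA (A : Blocks n m)
    (B : ∀ i, EuclideanSpace ℝ (Fin (n i)) → Matrix (Fin (n i)) (Fin (n i)) ℝ)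
    (x : Primal n) (i : Fin N) : Matrix (LocalIdx n m i) (LocalIdx n m i) ℝ :=
  Matrix.fromBlocks (-B i (x i)) (-(A i i)ᵀ) (A i i) 0

/-- `𝒜(x) = blkdiag(A_i(x_i))`. -/
def calA (A : Blocks n m)
    (B : ∀ i, EuclideanSpace ℝ (Fin (n i)) → Matrix (Fin (n i)) (Fin (n i)) ℝ)
    (x : Primal n) : Matrix (Idx n m) (Idx n m) ℝ :=
  Matrix.blockDiagonal' (localA A B x)

/-- `T_ij = [0, -A_jiᵀ; A_ij, 0]`. -/
def localT (A : Blocks n m) (i j : Fin N) : Matrix (LocalIdx n m i) (LocalIdx n m j) ℝ :=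
  Matrix.fromBlocks 0 (-(A j i)ᵀ) (A i j) 0

/-- The set `ℰ` of the communication channels: pairs `k = (i, j)` with `j ≠ i`, `T_ij ≠ 0`. -/
def Edge (A : Blocks n m) : Type :=
  {k : Fin N × Fin N // k.2 ≠ k.1 ∧ localT A k.1 k.2 ≠ 0}

instance (A : Blocks n m) : Finite (Edge A) :=
  inferInstanceAs (Finite {k : Fin N × Fin N // k.2 ≠ k.1 ∧ localT A k.1 k.2 ≠ 0})

instance (A : Blocks n m) : Fintype (Edge A) := Fintype.ofFinite _

instance (A : Blocks n m) : DecidableEq (Edge A) :=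
  inferInstanceAs (DecidableEq {k : Fin N × Fin N // k.2 ≠ k.1 ∧ localT A k.1 k.2 ≠ 0})

/-- `𝒯_k`, `k = (i, j)`: the `r × r` matrix whose `(i, j)` block is `T_ij` and whose other
blocks are zero. -/
def calT (A : Blocks n m) (k : Edge A) : Matrix (Idx n m) (Idx n m) ℝ :=
  Matrix.of fun a c => if a.1 = k.1.1 ∧ c.1 = k.1.2 then localT A a.1 c.1 a.2 c.2 else 0

end Matrices

/-- The symmetric completion `[U, V; *, W]`. -/
def symBlock {ι κ : Type} (U : Matrix ι ι ℝ) (V : Matrix ι κ ℝ) (W : Matrix κ κ ℝ) :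
    Matrix (ι ⊕ κ) (ι ⊕ κ) ℝ :=
  Matrix.fromBlocks U V Vᵀ W

/-- The block row `[M_1, …, M_ρ]`. -/
def blockRow {ι κ : Type} (M : κ → Matrix ι ι ℝ) : Matrix ι (ι × κ) ℝ :=
  Matrix.of fun a c => M c.2 a c.1

/-- The decision variables of the matrix inequalities. -/
structure Vars {N : ℕ} {n m : Fin N → ℕ} (A : Blocks n m) where
  Y11 : Matrix (Idx n m) (Idx n m) ℝ
  Y12 : Matrix (Idx n m) (Idx n m) ℝ
  Y22 : Matrix (Idx n m) (Idx n m) ℝ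
  R : Edge A → Matrix (Idx n m) (Idx n m) ℝ
  Q : Edge A → Matrix (Idx n m) (Idx n m) ℝ
  S : Edge A → Matrix (Idx n m) (Idx n m) ℝ
  S12 : Edge A → Matrix (Idx n m) (Idx n m) ℝ
  P2loc : ∀ i, Matrix (LocalIdx n m i) (LocalIdx n m i) ℝ
  Xloc : ∀ i, Matrix (LocalIdx n m i) (LocalIdx n m i) ℝ

namespace Vars

variable {N : ℕ} {n m : Fin N → ℕ} {A : Blocks n m}

/-- `P_2 = blkdiag(P_{2,i})`. -/
def P2 (D : Vars A) : Matrix (Idx n m) (Idx n m) ℝ := Matrix.blockDiagonal' D.P2loc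

/-- `X = blkdiag(X_i)`. -/
def X (D : Vars A) : Matrix (Idx n m) (Idx n m) ℝ := Matrix.blockDiagonal' D.Xloc

/-- The gain `𝒦 = (P_2ᵀ)⁻¹ X`. -/
def gain (D : Vars A) : Matrix (Idx n m) (Idx n m) ℝ := (D.P2ᵀ)⁻¹ * D.X

def phi11 (D : Vars A) : Matrix (Idx n m) (Idx n m) ℝ := -((2 : ℝ) • D.Y22)

def phi12 (D : Vars A) : Matrix (Idx n m) (Idx n m) ℝ := -D.Y12ᵀ + D.Y22 - D.Xᵀ

def phi13 (D : Vars A) (ε : ℝ) : Matrix (Idx n m) (Idx n m) ℝ := D.Y12ᵀ - ε • D.Xᵀ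

/-- `φ_22`, where `Ax` stands for `𝒜(x)`. -/
def phi22 (D : Vars A) (Ax : Matrix (Idx n m) (Idx n m) ℝ) : Matrix (Idx n m) (Idx n m) ℝ :=
  D.Y12 + D.Y12ᵀ + D.P2ᵀ * Ax + D.X + Axᵀ * D.P2 + D.Xᵀ + ∑ k, (D.S k + D.Q k - D.R k)

/-- `φ_23`, where `Ax` stands for `𝒜(x)`. -/
def phi23 (D : Vars A) (ε : ℝ) (Ax : Matrix (Idx n m) (Idx n m) ℝ) :
    Matrix (Idx n m) (Idx n m) ℝ :=
  D.Y11 - D.P2ᵀ + ε • (Axᵀ * D.P2) + ε • D.Xᵀ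

def phi24 (D : Vars A) : Matrix (Idx n m) (Idx n m × Edge A) ℝ := blockRow D.S12

def phi25 (D : Vars A) : Matrix (Idx n m) (Idx n m × Edge A) ℝ :=
  blockRow fun k => D.R k - D.S12 k + D.P2ᵀ * calT A k

def phi33 (D : Vars A) (ε : ℝ) (h : Edge A → ℝ) : Matrix (Idx n m) (Idx n m) ℝ :=
  -(ε • D.P2) - ε • D.P2ᵀ + ∑ k, h k ^ 2 • D.R k

def phi35 (D : Vars A) (ε : ℝ) : Matrix (Idx n m) (Idx n m × Edge A) ℝ :=
  blockRow fun k => ε • (D.P2ᵀ * calT A k)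

/-- `R = blkdiag(R_k)`. -/
def Rdiag (D : Vars A) : Matrix (Idx n m × Edge A) (Idx n m × Edge A) ℝ :=
  Matrix.blockDiagonal D.R

/-- `S = blkdiag(S_k)`. -/
def Sdiag (D : Vars A) : Matrix (Idx n m × Edge A) (Idx n m × Edge A) ℝ :=
  Matrix.blockDiagonal D.S

/-- `S_12 = blkdiag(S_{12,k})`. -/
def S12diag (D : Vars A) : Matrix (Idx n m × Edge A) (Idx n m × Edge A) ℝ :=
  Matrix.blockDiagonal D.S12

def phi44 (D : Vars A) : Matrix (Idx n m × Edge A) (Idx n m × Edge A) ℝ := -D.Sdiag - D.Rdiag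

def phi45 (D : Vars A) : Matrix (Idx n m × Edge A) (Idx n m × Edge A) ℝ :=
  D.Rdiag - D.S12diagᵀ

def phi55 (D : Vars A) (d : Edge A → ℝ) : Matrix (Idx n m × Edge A) (Idx n m × Edge A) ℝ :=
  -((2 : ℝ) • D.Rdiag) + D.S12diag + D.S12diagᵀ -
    Matrix.blockDiagonal fun k => (1 - d k) • D.Q k

/-- The symmetric five by five block matrix `Φ(x)`; its lower blocks are the transposes of the
upper ones. -/
def Phi (D : Vars A)
    (B : ∀ i, EuclideanSpace ℝ (Fin (n i)) → Matrix (Fin (n i)) (Fin (n i)) ℝ)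
    (ε : ℝ) (h d : Edge A → ℝ) (x : Primal n) :
    Matrix (Idx n m ⊕ Idx n m ⊕ Idx n m ⊕ (Idx n m × Edge A) ⊕ (Idx n m × Edge A))
      (Idx n m ⊕ Idx n m ⊕ Idx n m ⊕ (Idx n m × Edge A) ⊕ (Idx n m × Edge A)) ℝ :=
  symBlock D.phi11
      (Matrix.fromCols D.phi12 (Matrix.fromCols (D.phi13 ε) (Matrix.fromCols 0 0))) <|
    symBlock (D.phi22 (calA A B x))
        (Matrix.fromCols (D.phi23 ε (calA A B x)) (Matrix.fromCols D.phi24 D.phi25)) <|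
      symBlock (D.phi33 ε h) (Matrix.fromCols 0 (D.phi35 ε)) <|
        symBlock D.phi44 D.phi45 (D.phi55 d)

/-- The decision variables satisfy all the matrix inequalities except for the condition on the
`Q_k`. Positive (semi)definiteness includes symmetry. -/
structure Feasible (D : Vars A)
    (B : ∀ i, EuclideanSpace ℝ (Fin (n i)) → Matrix (Fin (n i)) (Fin (n i)) ℝ)
    (ε : ℝ) (h d : Edge A → ℝ) : Prop where
  R_pos : ∀ k, (D.R k).PosDef
  S_pos : ∀ k, (D.S k).PosDef
  P2_pos : ∀ i, (D.P2loc i + (D.P2loc i)ᵀ).PosDef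
  Phi_neg : ∀ x : Primal n, (-D.Phi B ε h d x).PosDef
  RS_nonneg : (symBlock D.Rdiag D.S12diag D.Rdiag).PosSemidef
  Y_pos : (symBlock D.Y11 D.Y12 D.Y22).PosDef

end Vars

section Dynamics

variable {N : ℕ} {n m : Fin N → ℕ}

/-- The primal point `x̂ = x̄ + x̃`, where `x̃` is the primal part of `z`. -/
def primalOf (xbar : Primal n) (z : StateSpace n m) : Primal n :=
  fun i => xbar i + WithLp.toLp 2 fun a => z ⟨i, Sum.inl a⟩

/-- The largest delay bound (`0` if there are no channels). -/
def maxDelay {A : Blocks n m} (h : Edge A → ℝ) : ℝ := ⨆ k, h k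

/-- The right-hand side `(𝒜(x̂) + 𝒦) z + ∑ₖ 𝒯ₖ z(t - τₖ(t)) - 𝒦 u` at time `t`. -/
def zRhs (A : Blocks n m)
    (B : ∀ i, EuclideanSpace ℝ (Fin (n i)) → Matrix (Fin (n i)) (Fin (n i)) ℝ)
    (xbar : Primal n) (K : Matrix (Idx n m) (Idx n m) ℝ) (τ : Edge A → ℝ → ℝ)
    (y : ℝ → StateSpace n m × StateSpace n m) (t : ℝ) : StateSpace n m :=
  WithLp.toLp 2
    ((calA A B (primalOf xbar (y t).1) + K) *ᵥ (y t).1.ofLp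
      + ∑ k, calT A k *ᵥ (y (t - τ k t)).1.ofLp - K *ᵥ (y t).2.ofLp)

/-- `y = (z, u)` solves the error dynamics on `[t₀, ∞)` (in the sense of Carathéodory):
`ż = (𝒜(x̂) + 𝒦) z + ∑ₖ 𝒯ₖ z(t - τₖ(t)) - 𝒦 u`, `u̇ = z - u`, with a continuous initial function
on `[t₀ - h, t₀]`, where `h` is the largest delay bound. -/
structure IsErrorSolution (A : Blocks n m)
    (B : ∀ i, EuclideanSpace ℝ (Fin (n i)) → Matrix (Fin (n i)) (Fin (n i)) ℝ)
    (xbar : Primal n) (K : Matrix (Idx n m) (Idx n m) ℝ) (h : Edge A → ℝ)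
    (τ : Edge A → ℝ → ℝ) (t₀ : ℝ) (y : ℝ → StateSpace n m × StateSpace n m) : Prop where
  cont : ContinuousOn y (Set.Ici (t₀ - maxDelay h))
  integrable : ∀ t, t₀ ≤ t →
    IntervalIntegrable (zRhs A B xbar K τ y) MeasureTheory.volume t₀ t
  z_eq : ∀ t, t₀ ≤ t → (y t).1 = (y t₀).1 + ∫ s in t₀..t, zRhs A B xbar K τ y s
  u_eq : ∀ t, t₀ ≤ t → (y t).2 = (y t₀).2 + ∫ s in t₀..t, ((y s).1 - (y s).2)

/-- Delay functions on `[0, ∞)` with values in `[0, h_k]`, without a condition on their rate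
(fast-varying delays). -/
structure FastDelays {A : Blocks n m} (h : Edge A → ℝ) (τ : Edge A → ℝ → ℝ) : Prop where
  measurable : ∀ k, AEMeasurable (τ k) (MeasureTheory.volume.restrict (Set.Ici 0))
  range : ∀ k, ∀ t, 0 ≤ t → τ k t ∈ Set.Icc 0 (h k)

/-- Delay functions on `[0, ∞)` with values in `[0, h_k]` that are differentiable, with
`|τ̇_k(t)| ≤ d_k` (the derivative at `0` is one-sided). -/
structure SlowDelays {A : Blocks n m} (h d : Edge A → ℝ) (τ : Edge A → ℝ → ℝ) : Prop where
  range : ∀ k, ∀ t, 0 ≤ t → τ k t ∈ Set.Icc 0 (h k)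
  diff : ∀ k, DifferentiableOn ℝ (τ k) (Set.Ici 0)
  rate : ∀ k, ∀ t, 0 ≤ t → |derivWithin (τ k) (Set.Ici 0) t| ≤ d k

end Dynamics

/-- Uniform asymptotic stability of the zero solution of a time-delay system with memory `h`
that lives on `[0, ∞)`; `Sol t₀ y` says that `y` is a solution with initial time `t₀`. The
initial function is measured in the supremum norm on `[t₀ - h, t₀]`, and `δ`, `δa` and `T` do
not depend on `t₀`. -/
def UniformlyAsymptoticallyStable {E : Type} [NormedAddCommGroup E] (h : ℝ)
    (Sol : ℝ → (ℝ → E) → Prop) : Prop :=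
  (∀ ε > 0, ∃ δ > 0, ∀ t₀ : ℝ, 0 ≤ t₀ → ∀ y, Sol t₀ y →
      (∀ s ∈ Set.Icc (t₀ - h) t₀, ‖y s‖ < δ) → ∀ t, t₀ ≤ t → ‖y t‖ < ε) ∧
  ∃ δa > 0, ∀ η > 0, ∃ T : ℝ, 0 ≤ T ∧ ∀ t₀ : ℝ, 0 ≤ t₀ → ∀ y, Sol t₀ y →
      (∀ s ∈ Set.Icc (t₀ - h) t₀, ‖y s‖ < δa) → ∀ t, t₀ + T ≤ t → ‖y t‖ < η

/-- The origin of the error dynamics with gain `K` and delays `τ` is uniformly asymptotically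
stable. -/
def ErrorUAS {N : ℕ} {n m : Fin N → ℕ} (A : Blocks n m)
    (B : ∀ i, EuclideanSpace ℝ (Fin (n i)) → Matrix (Fin (n i)) (Fin (n i)) ℝ)
    (xbar : Primal n) (K : Matrix (Idx n m) (Idx n m) ℝ) (h : Edge A → ℝ)
    (τ : Edge A → ℝ → ℝ) : Prop :=
  UniformlyAsymptoticallyStable (maxDelay h) (IsErrorSolution A B xbar K h τ)

end DelayPDGD

end

open DelayPDGD

/-!
The proof is by the Lyapunov–Krasovskii method. With `w = (z, u)` and `p = ż` the functional is
`V(t) = wᵀ Y w + ∑ₖ (∫_{t-h_k}^t zᵀ S_k z + h_k ∫_{t-h_k}^t (s - t + h_k) pᵀ R_k p ds)`, plus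
`∑ₖ ∫_{t-τₖ(t)}^t zᵀ Q_k z` if the rates of the delays are bounded (`HasDelayEnergy`). Its derivative
is at most `vᵀ Φ(x̂) v` with `v = (u, z, p, z(t - h_k), z(t - τₖ))` (`lyapDeriv_le`): the equation
of motion multiplied by `2 (z + ε p)ᵀ P₂ᵀ` contributes zero, because `P₂ᵀ 𝒦 = X`, and the
integrals of `pᵀ R_k p` are estimated by Jensen's inequality together with the reciprocally convex
combination inequality (`reciprocally_convex_le`). For delays of unbounded rate the `Q_k` terms of
`Φ` that remain are nonnegative or zero, so that `V` needs no `Q_k` part.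

The inequality `Φ(x̂) < 0` is only pointwise, and the matrices `B_i` need not depend continuously
on the point. This is harmless: in `vᵀ Φ(x̂) v` they occur only in the product `B_i(x̂_i) x̃_i`,
which is a difference of gradients. So `vᵀ Φ(x̂) v` is a continuous function of `v`, negative
unless `(z, u) = 0`, and bounded away from zero on compact sets of `v` away from `(z, u) = 0`
(`exists_dissipation_le`).

Solutions are only absolutely continuous, and their initial functions only continuous. Therefore
all changes of `V` are computed as integrals (`lyap_sub`), the `R_k` part being integrated by
parts (`doubleWindow`), and `V` is used only from time `t₀ + h` on, with `h` the largest delay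
bound; before that time an exponential growth bound suffices (`norm_le_exp_of_memory_bound`).
Together these give `‖y(t)‖ ≤ C sup ‖y‖` over the initial window (`exists_linear_bound`), which is
uniform stability. As solutions have bounded speed, every window on which `y` is not small lowers
`V` by a fixed amount, so a small window occurs within a uniform time (`exists_small_window`), and
attraction follows by restarting there.
-/

noncomputable section

namespace DelayPDGD

open MeasureTheory

/-! ### Bilinear forms and the quadratic form of `Φ` -/

/-- The bilinear form `xᵀ M y`. -/
def bil {ι κ : Type} [Fintype ι] [Fintype κ] (M : Matrix ι κ ℝ) (x : ι → ℝ) (y : κ → ℝ) : ℝ :=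
  x ⬝ᵥ M *ᵥ y

section Bil

variable {ι κ : Type} [Fintype ι] [Fintype κ]

theorem bil_add (M M' : Matrix ι κ ℝ) (x : ι → ℝ) (y : κ → ℝ) :
    bil (M + M') x y = bil M x y + bil M' x y := by
  simp [bil, Matrix.add_mulVec, dotProduct_add]

theorem bil_sub (M M' : Matrix ι κ ℝ) (x : ι → ℝ) (y : κ → ℝ) :
    bil (M - M') x y = bil M x y - bil M' x y := by
  simp [bil, Matrix.sub_mulVec, dotProduct_sub]

theorem bil_neg (M : Matrix ι κ ℝ) (x : ι → ℝ) (y : κ → ℝ) : bil (-M) x y = -bil M x y := by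
  simp [bil, Matrix.neg_mulVec]

theorem bil_smul (c : ℝ) (M : Matrix ι κ ℝ) (x : ι → ℝ) (y : κ → ℝ) :
    bil (c • M) x y = c * bil M x y := by
  simp [bil, Matrix.smul_mulVec]

theorem bil_zero (x : ι → ℝ) (y : κ → ℝ) : bil (0 : Matrix ι κ ℝ) x y = 0 := by
  simp [bil]

theorem bil_sum {σ : Type} (s : Finset σ) (M : σ → Matrix ι κ ℝ) (x : ι → ℝ) (y : κ → ℝ) :
    bil (∑ k ∈ s, M k) x y = ∑ k ∈ s, bil (M k) x y := by
  simp [bil, Matrix.sum_mulVec, dotProduct_sum]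

theorem bil_transpose (M : Matrix ι κ ℝ) (x : ι → ℝ) (y : κ → ℝ) : bil Mᵀ y x = bil M x y := by
  rw [bil, bil, Matrix.mulVec_transpose, dotProduct_comm, Matrix.dotProduct_mulVec]

theorem bil_comm_of_isSymm {M : Matrix ι ι ℝ} (hM : M.IsSymm) (x y : ι → ℝ) :
    bil M x y = bil M y x := by
  conv_lhs => rw [← hM.eq, bil_transpose]

theorem bil_add_left (M : Matrix ι κ ℝ) (x x' : ι → ℝ) (y : κ → ℝ) :
    bil M (x + x') y = bil M x y + bil M x' y := by
  simp [bil, add_dotProduct]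

theorem bil_add_right (M : Matrix ι κ ℝ) (x : ι → ℝ) (y y' : κ → ℝ) :
    bil M x (y + y') = bil M x y + bil M x y' := by
  simp [bil, Matrix.mulVec_add, dotProduct_add]

theorem bil_sub_left (M : Matrix ι κ ℝ) (x x' : ι → ℝ) (y : κ → ℝ) :
    bil M (x - x') y = bil M x y - bil M x' y := by
  simp [bil, sub_dotProduct]

theorem bil_sub_right (M : Matrix ι κ ℝ) (x : ι → ℝ) (y y' : κ → ℝ) :
    bil M x (y - y') = bil M x y - bil M x y' := by
  simp [bil, Matrix.mulVec_sub, dotProduct_sub]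

theorem bil_smul_left (c : ℝ) (M : Matrix ι κ ℝ) (x : ι → ℝ) (y : κ → ℝ) :
    bil M (c • x) y = c * bil M x y := by
  simp [bil]

theorem bil_smul_right (c : ℝ) (M : Matrix ι κ ℝ) (x : ι → ℝ) (y : κ → ℝ) :
    bil M x (c • y) = c * bil M x y := by
  simp [bil, Matrix.mulVec_smul]

theorem bil_sum_right {σ : Type} (s : Finset σ) (M : Matrix ι κ ℝ) (x : ι → ℝ)
    (y : σ → κ → ℝ) : bil M x (∑ k ∈ s, y k) = ∑ k ∈ s, bil M x (y k) := by
  simp [bil, Matrix.mulVec_sum, dotProduct_sum]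

theorem bil_mul {σ : Type} [Fintype σ] (M : Matrix ι κ ℝ) (M' : Matrix κ σ ℝ) (x : ι → ℝ)
    (y : σ → ℝ) : bil (M * M') x y = bil M x (M' *ᵥ y) := by
  simp [bil, Matrix.mulVec_mulVec]

theorem bil_apply (M : Matrix ι κ ℝ) (x : ι → ℝ) (y : κ → ℝ) :
    bil M x y = ∑ i, ∑ j, M i j * (x i * y j) := by
  simp only [bil, dotProduct, Matrix.mulVec, Finset.mul_sum]
  exact Finset.sum_congr rfl fun i _ => Finset.sum_congr rfl fun j _ => by ring

theorem bil_fromCols {σ : Type} [Fintype σ] (M : Matrix ι κ ℝ) (M' : Matrix ι σ ℝ) (x : ι → ℝ)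
    (y : κ → ℝ) (y' : σ → ℝ) :
    bil (Matrix.fromCols M M') x (Sum.elim y y') = bil M x y + bil M' x y' := by
  simp [bil, Matrix.fromCols_mulVec, dotProduct_add]

theorem bil_symBlock (U : Matrix ι ι ℝ) (V : Matrix ι κ ℝ) (W : Matrix κ κ ℝ) (x x' : ι → ℝ)
    (y y' : κ → ℝ) :
    bil (symBlock U V W) (Sum.elim x y) (Sum.elim x' y') =
      bil U x x' + bil V x y' + bil V x' y + bil W y y' := by
  have := bil_transpose V x' y
  simp only [bil] at this ⊢
  rw [symBlock, Matrix.fromBlocks_mulVec]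
  simp only [Sum.elim_comp_inl, Sum.elim_comp_inr, dotProduct_add, sumElim_dotProduct_sumElim]
  rw [this]
  ring

theorem bil_blockRow (M : κ → Matrix ι ι ℝ) (x : ι → ℝ) (y : κ → ι → ℝ) :
    bil (blockRow M) x (fun c => y c.2 c.1) = ∑ k, bil (M k) x (y k) := by
  simp only [bil_apply, blockRow, Matrix.of_apply]
  rw [Finset.sum_comm (s := (Finset.univ : Finset κ))]
  refine Finset.sum_congr rfl fun i _ => ?_
  rw [Fintype.sum_prod_type, Finset.sum_comm]

theorem bil_blockDiagonal [DecidableEq κ] (M : κ → Matrix ι ι ℝ) (x y : κ → ι → ℝ) :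
    bil (Matrix.blockDiagonal M) (fun c => x c.2 c.1) (fun c => y c.2 c.1) =
      ∑ k, bil (M k) (x k) (y k) := by
  simp only [bil_apply, Matrix.blockDiagonal_apply, Fintype.sum_prod_type]
  rw [Finset.sum_comm]
  refine Finset.sum_congr rfl fun k _ => Finset.sum_congr rfl fun i _ =>
    Finset.sum_congr rfl fun j _ => ?_
  simp

theorem bil_self_nonneg {M : Matrix ι ι ℝ} (hM : M.PosSemidef) (x : ι → ℝ) : 0 ≤ bil M x x := by
  simpa [bil] using hM.dotProduct_mulVec_nonneg x

theorem bil_self_pos {M : Matrix ι ι ℝ} (hM : M.PosDef) {x : ι → ℝ} (hx : x ≠ 0) :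
    0 < bil M x x := by
  simpa [bil] using hM.dotProduct_mulVec_pos hx

theorem blockDiagonal'_mulVec_apply {σ : Type} {ν : σ → Type} [Fintype σ] [DecidableEq σ]
    [∀ i, Fintype (ν i)] (M : ∀ i, Matrix (ν i) (ν i) ℝ) (v : (Σ i, ν i) → ℝ) (i : σ) (a : ν i) :
    (Matrix.blockDiagonal' M *ᵥ v) ⟨i, a⟩ = (M i *ᵥ fun c => v ⟨i, c⟩) a := by
  simp only [Matrix.mulVec, dotProduct, Fintype.sum_sigma]
  rw [Finset.sum_eq_single i]
  · simp only [Matrix.blockDiagonal'_apply_eq]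
  · intro j _ hj
    simp [Matrix.blockDiagonal'_apply_ne M _ _ hj.symm]
  · simp

end Bil

section Dissipation

variable {N : ℕ} {n m : Fin N → ℕ} {A : Blocks n m}

/-- The quadratic form `vᵀ Φ(x) v` at `v = col(u, z, p, col(a_k), col(b_k))`, written out. Here
`p`, `a_k`, `b_k` stand for `ż(t)`, `z(t - h_k)`, `z(t - τ_k(t))`, and `g` stands for
`𝒜(x) z`. The terms are, in this order: the derivative of the quadratic form of `(z, u)` given by
`Y`, the descriptor term `2 (z + ε p)ᵀ P₂ᵀ (ż - p)` with `P₂ᵀ 𝒦` replaced by `X`, and the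
contributions of the channels. -/
def dissipation (D : Vars A) (ε : ℝ) (h d : Edge A → ℝ) (u z p : Idx n m → ℝ)
    (a b : Edge A → Idx n m → ℝ) (g : Idx n m → ℝ) : ℝ :=
  2 * (bil D.Y11 z p + bil D.Y12 p u + bil D.Y12 z (z - u) + bil D.Y22 u (z - u)) +
  2 * (bil D.P2ᵀ (z + ε • p) (g + ∑ k, calT A k *ᵥ b k - p) + bil D.X (z + ε • p) (z - u)) +
  ∑ k, (bil (D.S k) z z - bil (D.S k) (a k) (a k) +
    (bil (D.Q k) z z - (1 - d k) * bil (D.Q k) (b k) (b k)) +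
    h k ^ 2 * bil (D.R k) p p -
    (bil (D.R k) (z - b k) (z - b k) + 2 * bil (D.S12 k) (z - b k) (b k - a k) +
      bil (D.R k) (b k - a k) (b k - a k)))

theorem bil_Phi (D : Vars A)
    (B : ∀ i, EuclideanSpace ℝ (Fin (n i)) → Matrix (Fin (n i)) (Fin (n i)) ℝ)
    (ε : ℝ) (h d : Edge A → ℝ) (hR : ∀ k, (D.R k).IsSymm) (x : Primal n)
    (u z p : Idx n m → ℝ) (a b : Edge A → Idx n m → ℝ) :
    bil (D.Phi B ε h d x)
      (Sum.elim u <| Sum.elim z <| Sum.elim p <|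
        Sum.elim (fun c => a c.2 c.1) (fun c => b c.2 c.1))
      (Sum.elim u <| Sum.elim z <| Sum.elim p <|
        Sum.elim (fun c => a c.2 c.1) (fun c => b c.2 c.1)) =
    dissipation D ε h d u z p a b (calA A B x *ᵥ z) := by
  have hRb : ∀ k, bil (D.R k) (b k) z = bil (D.R k) z (b k) := fun k =>
    bil_comm_of_isSymm (hR k) _ _
  have hRa : ∀ k, bil (D.R k) (b k) (a k) = bil (D.R k) (a k) (b k) := fun k =>
    bil_comm_of_isSymm (hR k) _ _
  have hA : ∀ y : Idx n m → ℝ, bil (calA A B x) (D.P2 *ᵥ y) z = bil D.P2 (calA A B x *ᵥ z) y :=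
    fun y => dotProduct_comm _ _
  simp only [Vars.Phi, bil_symBlock, bil_fromCols, Vars.phi11, Vars.phi12, Vars.phi13, Vars.phi22,
    Vars.phi23, Vars.phi24, Vars.phi25, Vars.phi33, Vars.phi35, Vars.phi44, Vars.phi45,
    Vars.phi55, Vars.Rdiag, Vars.Sdiag, Vars.S12diag, bil_blockRow, bil_add, bil_sub, bil_neg,
    bil_smul, bil_sum, bil_zero, bil_transpose, bil_blockDiagonal, bil_mul, dissipation,
    bil_add_left, bil_add_right, bil_sub_left, bil_sub_right, bil_smul_left, bil_sum_right,
    Finset.sum_add_distrib, Finset.sum_sub_distrib, mul_add, mul_sub, hRb, hRa, hA,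
    ← Finset.mul_sum]
  ring

theorem dissipation_neg {D : Vars A}
    {B : ∀ i, EuclideanSpace ℝ (Fin (n i)) → Matrix (Fin (n i)) (Fin (n i)) ℝ}
    {ε : ℝ} {h d : Edge A → ℝ} (hD : D.Feasible B ε h d) (x : Primal n)
    {u z : Idx n m → ℝ} (p : Idx n m → ℝ) (a b : Edge A → Idx n m → ℝ)
    (huz : ¬(z = 0 ∧ u = 0)) :
    dissipation D ε h d u z p a b (calA A B x *ᵥ z) < 0 := by
  rw [← bil_Phi D B ε h d (fun k => by simpa using (hD.R_pos k).isHermitian) x u z p a b]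
  have := bil_self_pos (hD.Phi_neg x) (x := Sum.elim u <| Sum.elim z <| Sum.elim p <|
        Sum.elim (fun c => a c.2 c.1) (fun c => b c.2 c.1)) ?_
  · rw [bil_neg] at this
    linarith
  · intro h0
    refine huz ⟨funext fun i => ?_, funext fun i => ?_⟩
    · exact congrFun h0 (Sum.inr (Sum.inl i))
    · exact congrFun h0 (Sum.inl i)

theorem dissipation_nonpos {D : Vars A}
    {B : ∀ i, EuclideanSpace ℝ (Fin (n i)) → Matrix (Fin (n i)) (Fin (n i)) ℝ}
    {ε : ℝ} {h d : Edge A → ℝ} (hD : D.Feasible B ε h d) (x : Primal n)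
    (u z p : Idx n m → ℝ) (a b : Edge A → Idx n m → ℝ) :
    dissipation D ε h d u z p a b (calA A B x *ᵥ z) ≤ 0 := by
  rw [← bil_Phi D B ε h d (fun k => by simpa using (hD.R_pos k).isHermitian) x u z p a b]
  have := bil_self_nonneg (hD.Phi_neg x).posSemidef (Sum.elim u <| Sum.elim z <| Sum.elim p <|
        Sum.elim (fun c => a c.2 c.1) (fun c => b c.2 c.1))
  rw [bil_neg] at this
  linarith

theorem Vars.P2_transpose_mul_gain {D : Vars A} (hP : ∀ i, (D.P2loc i + (D.P2loc i)ᵀ).PosDef) :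
    D.P2ᵀ * D.gain = D.X := by
  have : IsUnit (D.P2ᵀ).det := by
    rw [Matrix.det_transpose, isUnit_iff_ne_zero]
    intro h0
    obtain ⟨v, hv, hv0⟩ := Matrix.exists_mulVec_eq_zero_iff.mpr h0
    refine hv (funext fun ⟨i, a⟩ => ?_)
    have hi : D.P2loc i *ᵥ (fun c => v ⟨i, c⟩) = 0 := funext fun c => by
      rw [← blockDiagonal'_mulVec_apply, ← Vars.P2, hv0]
      rfl
    by_contra hne
    have h1 := bil_self_pos (hP i) (x := fun c => v ⟨i, c⟩) fun h => hne (congrFun h a)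
    rw [bil_add, bil_transpose, bil, hi] at h1
    simp at h1
  rw [Vars.gain, Matrix.mul_nonsing_inv_cancel_left _ _ this]

/-- Per channel, the matrix inequality on `[R, S₁₂; *, R]` bounds the cross term. -/
theorem Vars.Feasible.cross_nonneg {D : Vars A}
    {B : ∀ i, EuclideanSpace ℝ (Fin (n i)) → Matrix (Fin (n i)) (Fin (n i)) ℝ}
    {ε : ℝ} {h d : Edge A → ℝ} (hD : D.Feasible B ε h d) (k : Edge A) (x y : Idx n m → ℝ) :
    0 ≤ bil (D.R k) x x + 2 * bil (D.S12 k) x y + bil (D.R k) y y := by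
  have h0 := bil_self_nonneg hD.RS_nonneg
    (Sum.elim (fun c => (Pi.single k x : Edge A → Idx n m → ℝ) c.2 c.1)
      (fun c => (Pi.single k y : Edge A → Idx n m → ℝ) c.2 c.1))
  rw [bil_symBlock, Vars.Rdiag, Vars.S12diag, bil_blockDiagonal, bil_blockDiagonal,
    bil_blockDiagonal, Finset.sum_eq_single k, Finset.sum_eq_single k,
    Finset.sum_eq_single k] at h0
  · simp only [Pi.single_eq_same] at h0
    linarith
  all_goals first | (intro j _ hj; simp [hj, bil]) | simp

end Dissipation

/-! ### Product rule and Jensen's inequality -/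

theorem intervalIntegrable_finsetSum {σ : Type} (s : Finset σ) {f : σ → ℝ → ℝ} {a b : ℝ}
    (hf : ∀ i ∈ s, IntervalIntegrable (f i) volume a b) :
    IntervalIntegrable (fun t => ∑ i ∈ s, f i t) volume a b := by
  have := IntervalIntegrable.sum s hf
  rwa [show (∑ i ∈ s, f i) = fun t => ∑ i ∈ s, f i t from funext fun t => by simp] at this

theorem intervalIntegral_nonpos {f : ℝ → ℝ} {a b : ℝ} (hab : a ≤ b)
    (hf : ∀ t ∈ Set.Icc a b, f t ≤ 0) : ∫ t in a..b, f t ≤ 0 := by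
  have := intervalIntegral.integral_nonneg (μ := volume) (f := fun t => -f t) hab
    fun t ht => neg_nonneg.mpr (hf t ht)
  rwa [intervalIntegral.integral_neg, neg_nonneg] at this

/-- If two functions are primitives of integrable functions, their product is the primitive of
the function given by the product rule. -/
theorem integral_product_rule {f g p q : ℝ → ℝ} {a b : ℝ} (hab : a ≤ b)
    (hp : IntervalIntegrable p volume a b) (hq : IntervalIntegrable q volume a b)
    (hf : ∀ t ∈ Set.Icc a b, f t = f a + ∫ s in a..t, p s)
    (hg : ∀ t ∈ Set.Icc a b, g t = g a + ∫ s in a..t, q s) :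
    f b * g b - f a * g a = ∫ t in a..b, (p t * g t + f t * q t) := by
  set F : ℝ → ℝ := fun t => f a + ∫ s in a..t, p s with hF
  set G : ℝ → ℝ := fun t => g a + ∫ s in a..t, q s with hG
  have cst : ∀ c : ℝ, AbsolutelyContinuousOnInterval (fun _ : ℝ => c) a b := fun c =>
    (LipschitzWith.const c).lipschitzOnWith.absolutelyContinuousOnInterval
  have hFa : AbsolutelyContinuousOnInterval F a b :=
    (cst (f a)).add (hp.absolutelyContinuousOnInterval_intervalIntegral (by simp))
  have hGa : AbsolutelyContinuousOnInterval G a b :=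
    (cst (g a)).add (hq.absolutelyContinuousOnInterval_intervalIntegral (by simp))
  have hb : b ∈ Set.Icc a b := ⟨hab, le_rfl⟩
  have key := hFa.integral_deriv_mul_eq_sub hGa
  have e1 : F a = f a := by simp [hF]
  have e2 : G a = g a := by simp [hG]
  rw [e1, e2, show F b = f b from (hf b hb).symm, show G b = g b from (hg b hb).symm] at key
  rw [← key]
  refine intervalIntegral.integral_congr_ae ?_
  filter_upwards [hp.ae_hasDerivAt_integral, hq.ae_hasDerivAt_integral] with t h1 h2 ht
  have ht' : t ∈ Set.uIcc a b := Set.uIoc_subset_uIcc ht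
  have d1 : HasDerivAt F (p t) t := (h1 ht' a (by simp)).const_add _
  have d2 : HasDerivAt G (q t) t := (h2 ht' a (by simp)).const_add _
  rw [Set.uIcc_of_le hab] at ht'
  rw [d1.deriv, d2.deriv, hf t ht', hg t ht']

section

variable {ι : Type} [Fintype ι]

theorem bil_product_rule (M : Matrix ι ι ℝ) {x p : ℝ → ι → ℝ} {a b : ℝ} (hab : a ≤ b)
    (hc : ContinuousOn x (Set.Icc a b))
    (hp : ∀ i, IntervalIntegrable (fun t => p t i) volume a b)
    (hx : ∀ t ∈ Set.Icc a b, ∀ i, x t i = x a i + ∫ s in a..t, p s i) :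
    IntervalIntegrable (fun t => bil M (p t) (x t) + bil M (x t) (p t)) volume a b ∧
    bil M (x b) (x b) - bil M (x a) (x a) =
      ∫ t in a..b, (bil M (p t) (x t) + bil M (x t) (p t)) := by
  have hci : ∀ i, ContinuousOn (fun t => x t i) (Set.uIcc a b) := fun i => by
    rw [Set.uIcc_of_le hab]
    exact (continuous_apply i).comp_continuousOn hc
  have hint : ∀ i j, IntervalIntegrable (fun t => M i j * (p t i * x t j + x t i * p t j))
      volume a b := fun i j =>
    (((hp i).mul_continuousOn (hci j)).add ((hp j).continuousOn_mul (hci i))).const_mul _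
  have e : (fun t => bil M (p t) (x t) + bil M (x t) (p t)) =
      fun t => ∑ i, ∑ j, M i j * (p t i * x t j + x t i * p t j) := by
    funext t
    simp only [bil_apply, ← Finset.sum_add_distrib, mul_add]
  have hint' : ∀ i, IntervalIntegrable
      (fun t => ∑ j, M i j * (p t i * x t j + x t i * p t j)) volume a b := fun i => 
    intervalIntegrable_finsetSum _ fun j _ => hint i j
  rw [e]
  refine ⟨intervalIntegrable_finsetSum _ fun i _ => hint' i, ?_⟩
  rw [intervalIntegral.integral_finsetSum fun i _ => hint' i, bil_apply, bil_apply,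
    ← Finset.sum_sub_distrib]
  refine Finset.sum_congr rfl fun i _ => ?_
  rw [intervalIntegral.integral_finsetSum fun j _ => hint i j, ← Finset.sum_sub_distrib]
  refine Finset.sum_congr rfl fun j _ => ?_
  rw [intervalIntegral.integral_const_mul, ← integral_product_rule hab (hp i) (hp j)
    (fun t ht => hx t ht i) (fun t ht => hx t ht j)]
  ring

/-- Jensen's inequality for a quadratic form. -/
theorem bil_integral_le {R : Matrix ι ι ℝ} (hR : R.PosSemidef) {p : ℝ → ι → ℝ} {a b : ℝ}
    (hab : a ≤ b) (hp : ∀ i, IntervalIntegrable (fun t => p t i) volume a b)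
    (hpp : IntervalIntegrable (fun t => bil R (p t) (p t)) volume a b)
    {ξ : ι → ℝ} (hξ : ∀ i, ξ i = ∫ t in a..b, p t i) :
    bil R ξ ξ ≤ (b - a) * ∫ t in a..b, bil R (p t) (p t) := by
  rcases hab.eq_or_lt with rfl | hlt
  · have : ξ = 0 := funext fun i => by simp [hξ i]
    simp [this, bil]
  have hs : R.IsSymm := by simpa using hR.isHermitian
  have hlin : IntervalIntegrable (fun t => bil R ξ (p t)) volume a b ∧
      ∫ t in a..b, bil R ξ (p t) = bil R ξ ξ := by
    have e : ∀ v, bil R ξ v = ∑ j, (∑ i, R i j * ξ i) * v j := fun v => by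
      rw [bil_apply, Finset.sum_comm]
      refine Finset.sum_congr rfl fun j _ => ?_
      rw [Finset.sum_mul]
      exact Finset.sum_congr rfl fun i _ => by ring
    simp only [e]
    refine ⟨intervalIntegrable_finsetSum _ fun j _ => (hp j).const_mul _, ?_⟩
    rw [intervalIntegral.integral_finsetSum fun j _ => (hp j).const_mul _]
    refine Finset.sum_congr rfl fun j _ => ?_
    rw [intervalIntegral.integral_const_mul, hξ j]
  have h0 : 0 ≤ ∫ t in a..b, ((b - a) ^ 2 * bil R (p t) (p t) - 2 * (b - a) * bil R ξ (p t)
      + bil R ξ ξ) := by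
    refine intervalIntegral.integral_nonneg hab fun t _ => ?_
    have := bil_self_nonneg hR ((b - a) • p t - ξ)
    simp only [bil_sub_left, bil_sub_right, bil_smul_left, bil_smul_right,
      bil_comm_of_isSymm hs (p t) ξ] at this
    linarith
  rw [intervalIntegral.integral_add ((hpp.const_mul _).sub (hlin.1.const_mul _)) (by simp),
    intervalIntegral.integral_sub (hpp.const_mul _) (hlin.1.const_mul _),
    intervalIntegral.integral_const_mul, intervalIntegral.integral_const_mul, hlin.2,
    intervalIntegral.integral_const, smul_eq_mul] at h0
  have h1 : 0 < b - a := by linarith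
  refine le_of_mul_le_mul_left ?_ h1
  linarith

/-- The reciprocally convex combination inequality: Jensen's inequality on the two parts of a
split interval, combined through the positive semidefiniteness of `[R, S; *, R]`. -/
theorem reciprocally_convex_le {R S : Matrix ι ι ℝ} (hR : R.PosSemidef)
    (hRS : ∀ x y, 0 ≤ bil R x x + 2 * bil S x y + bil R y y)
    {p : ℝ → ι → ℝ} {a c b : ℝ} (hac : a ≤ c) (hcb : c ≤ b)
    (hp : ∀ i, IntervalIntegrable (fun t => p t i) volume a b)
    (hpp : IntervalIntegrable (fun t => bil R (p t) (p t)) volume a b)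
    {ξ η : ι → ℝ} (hξ : ∀ i, ξ i = ∫ t in c..b, p t i) (hη : ∀ i, η i = ∫ t in a..c, p t i) :
    bil R ξ ξ + 2 * bil S ξ η + bil R η η ≤ (b - a) * ∫ t in a..b, bil R (p t) (p t) := by
  have s1 : Set.uIcc a c ⊆ Set.uIcc a b := by
    rw [Set.uIcc_of_le hac, Set.uIcc_of_le (hac.trans hcb)]
    exact Set.Icc_subset_Icc_right hcb
  have s2 : Set.uIcc c b ⊆ Set.uIcc a b := by
    rw [Set.uIcc_of_le hcb, Set.uIcc_of_le (hac.trans hcb)]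
    exact Set.Icc_subset_Icc_left hac
  have j1 := bil_integral_le hR hcb (fun i => (hp i).mono_set s2) (hpp.mono_set s2) hξ
  have j2 := bil_integral_le hR hac (fun i => (hp i).mono_set s1) (hpp.mono_set s1) hη
  rw [← intervalIntegral.integral_add_adjacent_intervals (hpp.mono_set s1) (hpp.mono_set s2)]
  have n1 : 0 ≤ ∫ t in c..b, bil R (p t) (p t) :=
    intervalIntegral.integral_nonneg hcb fun t _ => bil_self_nonneg hR _
  have n2 : 0 ≤ ∫ t in a..c, bil R (p t) (p t) :=
    intervalIntegral.integral_nonneg hac fun t _ => bil_self_nonneg hR _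
  have hd : bil S ξ η ^ 2 ≤ bil R ξ ξ * bil R η η := by
    have := discrim_le_zero (a := bil R ξ ξ) (b := 2 * bil S ξ η) (c := bil R η η) fun s => by
      have := hRS (s • ξ) η
      simp only [bil_smul_left, bil_smul_right] at this
      linarith
    rw [discrim] at this
    linarith
  set J1 := ∫ t in c..b, bil R (p t) (p t)
  set J2 := ∫ t in a..c, bil R (p t) (p t)
  have r1 := bil_self_nonneg hR ξ
  have r2 := bil_self_nonneg hR η
  have hx : 0 ≤ (c - a) * J1 := mul_nonneg (by linarith) n1
  have hy : 0 ≤ (b - c) * J2 := mul_nonneg (by linarith) n2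
  have hprod : bil S ξ η ^ 2 ≤ ((c - a) * J1) * ((b - c) * J2) := by
    calc _ ≤ bil R ξ ξ * bil R η η := hd
      _ ≤ ((b - c) * J1) * ((c - a) * J2) := mul_le_mul j1 j2 r2 (r1.trans j1)
      _ = _ := by ring
  have : 2 * bil S ξ η ≤ (c - a) * J1 + (b - c) * J2 := by
    have hsq : (2 * bil S ξ η) ^ 2 ≤ ((c - a) * J1 + (b - c) * J2) ^ 2 := by
      nlinarith [sq_nonneg ((c - a) * J1 - (b - c) * J2)]
    exact le_of_abs_le (abs_le_of_sq_le_sq hsq (add_nonneg hx hy))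
  linarith

end

/-! ### The Lyapunov–Krasovskii functional and its derivative -/

/-- The integral over a sliding window is a primitive of `f t - f (t - h)`. -/
theorem integral_window_sub {f : ℝ → ℝ} (hf : ∀ a b, IntervalIntegrable f volume a b)
    (h a b : ℝ) :
    IntervalIntegrable (fun t => f t - f (t - h)) volume a b ∧
    (∫ s in (b - h)..b, f s) - ∫ s in (a - h)..a, f s = ∫ t in a..b, (f t - f (t - h)) := by
  have hs : IntervalIntegrable (fun t => f (t - h)) volume a b := by
    simpa using (hf (a - h) (b - h)).comp_sub_right h
  refine ⟨(hf a b).sub hs, ?_⟩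
  rw [intervalIntegral.integral_sub (hf a b) hs, intervalIntegral.integral_comp_sub_right f h,
    intervalIntegral.integral_interval_sub_interval_comm (hf _ _) (hf _ _) (hf _ _),
    intervalIntegral.integral_symm b a, intervalIntegral.integral_symm (b - h) (a - h)]
  ring

/-- The functional `h ∫_{t-h}^t (s - t + h) ρ(s) ds`, integrated by parts: in terms of the
primitive `P` of `ρ` it is `h (h P(t) - ∫_{t-h}^t P)`, which needs no differentiability of
`ρ`. The base point of the primitive is immaterial. -/
def doubleWindow (ρ : ℝ → ℝ) (h t₀ t : ℝ) : ℝ :=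
  h * (h * (∫ s in t₀..t, ρ s) - ∫ r in (t - h)..t, ∫ s in t₀..r, ρ s)

theorem doubleWindow_sub {ρ : ℝ → ℝ} (hρ : ∀ a b, IntervalIntegrable ρ volume a b)
    (h t₀ a b : ℝ) :
    IntervalIntegrable (fun t => h * (h * ρ t - ∫ s in (t - h)..t, ρ s)) volume a b ∧
    doubleWindow ρ h t₀ b - doubleWindow ρ h t₀ a =
      ∫ t in a..b, h * (h * ρ t - ∫ s in (t - h)..t, ρ s) := by
  have hP : Continuous fun r => ∫ s in t₀..r, ρ s := intervalIntegral.continuous_primitive hρ t₀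
  have hw := integral_window_sub (fun a b => hP.intervalIntegrable a b) h a b
  have e : (fun t => (∫ s in t₀..t, ρ s) - ∫ s in t₀..(t - h), ρ s) =
      fun t => ∫ s in (t - h)..t, ρ s := funext fun t =>
    intervalIntegral.integral_interval_sub_left (hρ _ _) (hρ _ _)
  rw [e] at hw
  refine ⟨(((hρ a b).const_mul h).sub hw.1).const_mul h, ?_⟩
  rw [intervalIntegral.integral_const_mul, intervalIntegral.integral_sub
    ((hρ a b).const_mul h) hw.1, ← hw.2, intervalIntegral.integral_const_mul,
    ← intervalIntegral.integral_interval_sub_left (hρ t₀ b) (hρ t₀ a)]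
  simp only [doubleWindow]
  ring

theorem doubleWindow_nonneg {ρ : ℝ → ℝ} (hρ : ∀ a b, IntervalIntegrable ρ volume a b)
    (h0 : ∀ t, 0 ≤ ρ t) {h : ℝ} (hh : 0 ≤ h) (t₀ t : ℝ) : 0 ≤ doubleWindow ρ h t₀ t := by
  have hP : Continuous fun r => ∫ s in t₀..r, ρ s := intervalIntegral.continuous_primitive hρ t₀
  have : ∫ r in (t - h)..t, ∫ s in t₀..r, ρ s ≤ ∫ _ in (t - h)..t, ∫ s in t₀..t, ρ s := by
    refine intervalIntegral.integral_mono_on (by linarith) (hP.intervalIntegrable _ _)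
      (by simp) fun r hr => ?_
    rw [← sub_nonneg, intervalIntegral.integral_interval_sub_left (hρ _ _) (hρ _ _)]
    exact intervalIntegral.integral_nonneg hr.2 fun s _ => h0 s
  rw [intervalIntegral.integral_const, smul_eq_mul] at this
  exact mul_nonneg hh (by linarith)

theorem doubleWindow_le {ρ : ℝ → ℝ} (hρ : ∀ a b, IntervalIntegrable ρ volume a b)
    {h C t : ℝ} (hh : 0 ≤ h) (h0 : ∀ s, 0 ≤ ρ s) (hC : ∀ s ∈ Set.Icc (t - h) t, ρ s ≤ C)
    (t₀ : ℝ) : doubleWindow ρ h t₀ t ≤ h * (h * (h * C)) := by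
  have hP : Continuous fun r => ∫ s in t₀..r, ρ s := intervalIntegral.continuous_primitive hρ t₀
  have h1 : ∫ _ in (t - h)..t, ∫ s in t₀..(t - h), ρ s ≤ ∫ r in (t - h)..t, ∫ s in t₀..r, ρ s := by
    refine intervalIntegral.integral_mono_on (by linarith) (by simp)
      (hP.intervalIntegrable _ _) fun r hr => ?_
    rw [← sub_nonneg, intervalIntegral.integral_interval_sub_left (hρ _ _) (hρ _ _)]
    exact intervalIntegral.integral_nonneg hr.1 fun s _ => h0 s
  have h2 : ∫ s in (t - h)..t, ρ s ≤ ∫ _ in (t - h)..t, C :=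
    intervalIntegral.integral_mono_on (by linarith) (hρ _ _) (by simp) hC
  rw [← intervalIntegral.integral_interval_sub_left (hρ t₀ t) (hρ t₀ (t - h))] at h2
  rw [intervalIntegral.integral_const, smul_eq_mul] at h1 h2
  refine mul_le_mul_of_nonneg_left ?_ hh
  have := mul_le_mul_of_nonneg_left h2 hh
  linarith

section Lyapunov

variable {N : ℕ} {n m : Fin N → ℕ} {A : Blocks n m}

/-- The Lyapunov–Krasovskii functional along `(z, u)` with `p = ż`, without its `Q_k` part. -/
def lyap (D : Vars A) (h : Edge A → ℝ) (t₀ : ℝ) (z u p : ℝ → Idx n m → ℝ) (t : ℝ) : ℝ :=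
  bil (symBlock D.Y11 D.Y12 D.Y22) (Sum.elim (z t) (u t)) (Sum.elim (z t) (u t)) +
  ∑ k, ((∫ s in (t - h k)..t, bil (D.S k) (z s) (z s)) +
    doubleWindow (fun s => bil (D.R k) (p s) (p s)) (h k) t₀ t)

/-- The almost everywhere derivative of `lyap`. -/
def lyapDeriv (D : Vars A) (h : Edge A → ℝ) (z u p : ℝ → Idx n m → ℝ) (t : ℝ) : ℝ :=
  2 * (bil D.Y11 (z t) (p t) + bil D.Y12 (p t) (u t) + bil D.Y12 (z t) (z t - u t) +
    bil D.Y22 (u t) (z t - u t)) +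
  ∑ k, (bil (D.S k) (z t) (z t) - bil (D.S k) (z (t - h k)) (z (t - h k)) +
    h k * (h k * bil (D.R k) (p t) (p t) -
      ∫ s in (t - h k)..t, bil (D.R k) (p s) (p s)))

theorem continuous_bil {X ι : Type} [TopologicalSpace X] [Fintype ι] (M : Matrix ι ι ℝ)
    {x y : X → ι → ℝ} (hx : Continuous x) (hy : Continuous y) :
    Continuous fun t => bil M (x t) (y t) := by
  simp only [bil_apply]
  fun_prop

theorem lyap_sub {D : Vars A} (hY : (symBlock D.Y11 D.Y12 D.Y22).IsSymm) (h : Edge A → ℝ)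
    {t₀ : ℝ} {z u p : ℝ → Idx n m → ℝ} (hz : Continuous z) (hu : Continuous u)
    (hp : ∀ i a b, IntervalIntegrable (fun t => p t i) volume a b)
    (hpp : ∀ k a b, IntervalIntegrable (fun t => bil (D.R k) (p t) (p t)) volume a b)
    {a b : ℝ} (hab : a ≤ b)
    (hzp : ∀ t ∈ Set.Icc a b, ∀ i, z t i = z a i + ∫ s in a..t, p s i)
    (hup : ∀ t ∈ Set.Icc a b, ∀ i, u t i = u a i + ∫ s in a..t, (z s i - u s i)) :
    IntervalIntegrable (lyapDeriv D h z u p) volume a b ∧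
    lyap D h t₀ z u p b - lyap D h t₀ z u p a = ∫ t in a..b, lyapDeriv D h z u p t := by
  have h1 := bil_product_rule (symBlock D.Y11 D.Y12 D.Y22) hab
    (x := fun t => Sum.elim (z t) (u t)) (p := fun t => Sum.elim (p t) (z t - u t))
    (Continuous.continuousOn <| continuous_pi fun i => by
      rcases i with i | i
      · exact (continuous_apply i).comp hz
      · exact (continuous_apply i).comp hu)
    (fun i => by
      rcases i with i | i
      · exact hp i a b
      · exact Continuous.intervalIntegrable
          (((continuous_apply i).comp hz).sub ((continuous_apply i).comp hu)) a b)
    (fun t ht i => by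
      rcases i with i | i
      · exact hzp t ht i
      · exact hup t ht i)
  have e : (fun t => bil (symBlock D.Y11 D.Y12 D.Y22) (Sum.elim (p t) (z t - u t))
        (Sum.elim (z t) (u t)) + bil (symBlock D.Y11 D.Y12 D.Y22) (Sum.elim (z t) (u t))
        (Sum.elim (p t) (z t - u t))) =
      fun t => 2 * (bil D.Y11 (z t) (p t) + bil D.Y12 (p t) (u t) + bil D.Y12 (z t) (z t - u t) +
        bil D.Y22 (u t) (z t - u t)) := funext fun t => by
    rw [bil_comm_of_isSymm hY, bil_symBlock]
    ring
  rw [e] at h1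
  have h2 := fun k => integral_window_sub
    (fun a b => (continuous_bil (D.S k) hz hz).intervalIntegrable a b) (h k) a b
  have h3 := fun k => doubleWindow_sub (hpp k) (h k) t₀ a b
  have h4 := intervalIntegrable_finsetSum (Finset.univ : Finset (Edge A))
    (fun k _ => (h2 k).1.add (h3 k).1)
  refine ⟨h1.1.add h4, ?_⟩
  simp only [lyapDeriv]
  rw [intervalIntegral.integral_add h1.1 h4, intervalIntegral.integral_finsetSum
    fun k _ => (h2 k).1.add (h3 k).1, ← h1.2]
  have h5 : ∀ k, (∫ t in a..b, (bil (D.S k) (z t) (z t) - bil (D.S k) (z (t - h k)) (z (t - h k)) +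
      h k * (h k * bil (D.R k) (p t) (p t) - ∫ s in (t - h k)..t, bil (D.R k) (p s) (p s)))) =
      ((∫ s in (b - h k)..b, bil (D.S k) (z s) (z s)) +
        doubleWindow (fun s => bil (D.R k) (p s) (p s)) (h k) t₀ b) -
      ((∫ s in (a - h k)..a, bil (D.S k) (z s) (z s)) +
        doubleWindow (fun s => bil (D.R k) (p s) (p s)) (h k) t₀ a) := fun k => by
    rw [intervalIntegral.integral_add (h2 k).1 (h3 k).1, ← (h2 k).2, ← (h3 k).2]
    ring
  simp only [h5, Finset.sum_sub_distrib, lyap]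
  ring

/-- Along solutions the derivative of the functional is at most the quadratic form of `Φ`: the
descriptor term vanishes, and the integral terms are estimated by the reciprocally convex
combination inequality. -/
theorem lyapDeriv_le {B : ∀ i, EuclideanSpace ℝ (Fin (n i)) → Matrix (Fin (n i)) (Fin (n i)) ℝ}
    {D : Vars A} {ε : ℝ} {h d : Edge A → ℝ} (hD : D.Feasible B ε h d)
    {z u p : ℝ → Idx n m → ℝ}
    (hp : ∀ i a b, IntervalIntegrable (fun t => p t i) volume a b)
    (hpp : ∀ k a b, IntervalIntegrable (fun t => bil (D.R k) (p t) (p t)) volume a b)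
    {t : ℝ} {τ : Edge A → ℝ} {g : Idx n m → ℝ} (hτ : ∀ k, τ k ∈ Set.Icc 0 (h k))
    (hz1 : ∀ k i, z t i = z (t - τ k) i + ∫ s in (t - τ k)..t, p s i)
    (hz2 : ∀ k i, z (t - τ k) i = z (t - h k) i + ∫ s in (t - h k)..(t - τ k), p s i)
    (hode : p t = g + D.gain *ᵥ (z t - u t) + ∑ k, calT A k *ᵥ z (t - τ k)) :
    lyapDeriv D h z u p t + ∑ k, (bil (D.Q k) (z t) (z t) -
        (1 - d k) * bil (D.Q k) (z (t - τ k)) (z (t - τ k))) ≤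
      dissipation D ε h d (u t) (z t) (p t) (fun k => z (t - h k)) (fun k => z (t - τ k)) g := by
  have hdesc : bil D.P2ᵀ (z t + ε • p t) (g + ∑ k, calT A k *ᵥ z (t - τ k) - p t) +
      bil D.X (z t + ε • p t) (z t - u t) = 0 := by
    rw [← Vars.P2_transpose_mul_gain hD.P2_pos, bil_mul, ← bil_add_right]
    have : g + ∑ k, calT A k *ᵥ z (t - τ k) - p t + D.gain *ᵥ (z t - u t) = 0 := by
      rw [hode]
      abel
    rw [this]
    simp [bil]
  have hJ : ∀ k, bil (D.R k) (z t - z (t - τ k)) (z t - z (t - τ k)) +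
      2 * bil (D.S12 k) (z t - z (t - τ k)) (z (t - τ k) - z (t - h k)) +
      bil (D.R k) (z (t - τ k) - z (t - h k)) (z (t - τ k) - z (t - h k)) ≤
      h k * ∫ s in (t - h k)..t, bil (D.R k) (p s) (p s) := fun k => by
    have := reciprocally_convex_le (hD.R_pos k).posSemidef (hD.cross_nonneg k)
      (a := t - h k) (c := t - τ k) (b := t) (by linarith [(hτ k).2]) (by linarith [(hτ k).1])
      (fun i => hp i _ _) (hpp k _ _) (ξ := z t - z (t - τ k)) (η := z (t - τ k) - z (t - h k))
      (fun i => by simp [hz1 k i]) (fun i => by simp [hz2 k i])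
    simpa using this
  rw [dissipation, lyapDeriv, hdesc, add_assoc, ← Finset.sum_add_distrib]
  simp only [mul_zero, add_zero]
  gcongr with k
  have := hJ k
  simp only [mul_sub]
  linarith

end Lyapunov

/-! ### Bounds and continuity of the vector field -/

section Bounds

theorem norm_toLp_le_sum {ι : Type} [Fintype ι] [DecidableEq ι] (w : ι → ℝ) :
    ‖(WithLp.toLp 2 w : EuclideanSpace ℝ ι)‖ ≤ ∑ i, |w i| := by
  have : (WithLp.toLp 2 w : EuclideanSpace ℝ ι) = ∑ i, EuclideanSpace.single i (w i) := by
    ext j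
    simp [Pi.single_apply]
  rw [this]
  refine (norm_sum_le _ _).trans (le_of_eq ?_)
  simp

theorem norm_toLp_mulVec_le {ι : Type} [Fintype ι] [DecidableEq ι] {M : Matrix ι ι ℝ} {C : ℝ}
    (hM : ∀ i j, |M i j| ≤ C) (v : EuclideanSpace ℝ ι) :
    ‖(WithLp.toLp 2 (M *ᵥ v.ofLp) : EuclideanSpace ℝ ι)‖ ≤
      (Fintype.card ι * (Fintype.card ι * C)) * ‖v‖ := by
  have h1 : ∀ i, |(M *ᵥ v.ofLp) i| ≤ Fintype.card ι * C * ‖v‖ := fun i => by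
    calc _ ≤ ∑ j, |M i j * v j| := Finset.abs_sum_le_sum_abs _ _
      _ ≤ ∑ _j : ι, C * ‖v‖ := Finset.sum_le_sum fun j _ => by
          rw [abs_mul]
          have := PiLp.norm_apply_le v j
          rw [Real.norm_eq_abs] at this
          exact mul_le_mul (hM i j) this (abs_nonneg _) ((abs_nonneg _).trans (hM i j))
      _ = _ := by simp [mul_assoc]
  calc _ ≤ ∑ i, |(M *ᵥ v.ofLp) i| := norm_toLp_le_sum _
    _ ≤ ∑ _i : ι, Fintype.card ι * C * ‖v‖ := Finset.sum_le_sum fun i _ => h1 i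
    _ = _ := by
      simp
      ring

theorem abs_entry_le_of_posSemidef {k : ℕ} {M : Matrix (Fin k) (Fin k) ℝ} {ℓ : ℝ}
    (h0 : M.PosSemidef) (h1 : (ℓ • (1 : Matrix (Fin k) (Fin k) ℝ) - M).PosSemidef)
    (i j : Fin k) : |M i j| ≤ 2 * |ℓ| := by
  have hs : M.IsSymm := by simpa using h0.isHermitian
  have e : ∀ a b, bil M (Pi.single a 1) (Pi.single b 1) = M a b := fun a b => by simp [bil]
  have e1 : ∀ a b : Fin k, bil (1 : Matrix (Fin k) (Fin k) ℝ) (Pi.single a 1) (Pi.single b 1) =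
      (1 : Matrix (Fin k) (Fin k) ℝ) a b := fun a b => by simp [bil]
  have hij : 0 ≤ (1 : Matrix (Fin k) (Fin k) ℝ) i j ∧ (1 : Matrix (Fin k) (Fin k) ℝ) i j ≤ 1 := by
    rw [Matrix.one_apply]
    split_ifs <;> simp
  have a1 := bil_self_nonneg h0 (Pi.single i 1 + Pi.single j 1)
  have a2 := bil_self_nonneg h0 (Pi.single i 1 - Pi.single j 1)
  have b1 := bil_self_nonneg h1 (Pi.single i 1)
  have b2 := bil_self_nonneg h1 (Pi.single j 1)
  have c1 := hs.apply i j
  simp only [bil_add_left, bil_add_right, bil_sub_left, bil_sub_right, bil_sub, bil_smul, e, e1,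
    Matrix.one_apply_eq, c1] at a1 a2 b1 b2
  have := le_abs_self ℓ
  rw [abs_le]
  constructor <;> linarith

variable {N : ℕ} {n m : Fin N → ℕ}

theorem exists_calA_bound (A : Blocks n m) {f : ∀ i, EuclideanSpace ℝ (Fin (n i)) → ℝ}
    {μ ℓ : Fin N → ℝ} (hμ : ∀ i, 0 < μ i) {xbar : Primal n}
    {B : ∀ i, EuclideanSpace ℝ (Fin (n i)) → Matrix (Fin (n i)) (Fin (n i)) ℝ}
    (hB : ∀ i, IsSecantFamily (f i) (μ i) (ℓ i) (xbar i) (B i)) :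
    ∃ C, 0 ≤ C ∧ ∀ x a c, |calA A B x a c| ≤ C := by
  have hBb : ∀ i y a c, |B i y a c| ≤ 2 * |ℓ i| := fun i y a c => by
    obtain ⟨-, h1, h2, -⟩ := hB i y
    refine abs_entry_le_of_posSemidef ?_ h2 a c
    have := h1.add (Matrix.PosSemidef.one.smul (hμ i).le)
    simpa using this
  have hA : ∀ i a c, |A i i a c| ≤ ∑ i, ∑ a, ∑ c, |A i i a c| := fun i a c => by
    refine le_trans ?_ (Finset.single_le_sum (f := fun i => ∑ a, ∑ c, |A i i a c|)
      (fun _ _ => by positivity) (Finset.mem_univ i))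
    refine le_trans ?_ (Finset.single_le_sum (f := fun a => ∑ c, |A i i a c|)
      (fun _ _ => by positivity) (Finset.mem_univ a))
    exact Finset.single_le_sum (f := fun c => |A i i a c|)
      (fun _ _ => by positivity) (Finset.mem_univ c)
  have hl : ∀ i, 2 * |ℓ i| ≤ ∑ i, 2 * |ℓ i| := fun i =>
    Finset.single_le_sum (f := fun i => 2 * |ℓ i|) (fun _ _ => by positivity) (Finset.mem_univ i)
  have hl0 : 0 ≤ ∑ i, 2 * |ℓ i| := by positivity
  have hA0 : 0 ≤ ∑ i, ∑ a, ∑ c, |A i i a c| := by positivity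
  refine ⟨(∑ i, 2 * |ℓ i|) + ∑ i, ∑ a, ∑ c, |A i i a c|, by positivity, ?_⟩
  rintro x ⟨i, a⟩ ⟨j, c⟩
  by_cases hij : i = j
  · subst hij
    rw [calA, Matrix.blockDiagonal'_apply_eq]
    rcases a with a | a <;> rcases c with c | c
    · simp only [localA, Matrix.fromBlocks_apply₁₁, Matrix.neg_apply, abs_neg]
      linarith [hBb i (x i) a c, hl i]
    · simp only [localA, Matrix.fromBlocks_apply₁₂, Matrix.neg_apply, abs_neg,
        Matrix.transpose_apply]
      linarith [hA i c a]
    · simp only [localA, Matrix.fromBlocks_apply₂₁]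
      linarith [hA i a c]
    · simp only [localA, Matrix.fromBlocks_apply₂₂, Matrix.zero_apply, abs_zero]
      positivity
  · rw [calA, Matrix.blockDiagonal'_apply_ne _ _ _ hij, abs_zero]
    positivity

theorem exists_entry_bound {ι : Type} [Finite ι] (M : Matrix ι ι ℝ) :
    ∃ C, 0 ≤ C ∧ ∀ i j, |M i j| ≤ C := by
  obtain ⟨C, hC⟩ := Finite.bddAbove_range fun q : ι × ι => |M q.1 q.2|
  exact ⟨max C 0, le_max_right _ _, fun i j => (hC ⟨(i, j), rfl⟩).trans (le_max_left _ _)⟩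

theorem le_maxDelay {A : Blocks n m} (h : Edge A → ℝ) (k : Edge A) : h k ≤ maxDelay h :=
  le_ciSup (Finite.bddAbove_range h) k

theorem maxDelay_nonneg {A : Blocks n m} {h : Edge A → ℝ} (hh : ∀ k, 0 ≤ h k) :
    0 ≤ maxDelay h :=
  Real.iSup_nonneg hh

/-- The vector field is bounded linearly by the supremum of the state over the memory window,
uniformly in time and in the delays. -/
theorem exists_zRhs_bound (A : Blocks n m) {f : ∀ i, EuclideanSpace ℝ (Fin (n i)) → ℝ}
    {μ ℓ : Fin N → ℝ} (hμ : ∀ i, 0 < μ i) {xbar : Primal n}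
    {B : ∀ i, EuclideanSpace ℝ (Fin (n i)) → Matrix (Fin (n i)) (Fin (n i)) ℝ}
    (hB : ∀ i, IsSecantFamily (f i) (μ i) (ℓ i) (xbar i) (B i))
    (K : Matrix (Idx n m) (Idx n m) ℝ) {h : Edge A → ℝ} (hh : ∀ k, 0 ≤ h k) :
    ∃ L, 0 ≤ L ∧ ∀ (τ : Edge A → ℝ → ℝ) (y : ℝ → StateSpace n m × StateSpace n m) (t δ : ℝ),
      (∀ k, τ k t ∈ Set.Icc 0 (h k)) → (∀ s ∈ Set.Icc (t - maxDelay h) t, ‖y s‖ ≤ δ) →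
      ‖zRhs A B xbar K τ y t‖ ≤ L * δ := by
  obtain ⟨CA, hCA0, hCA⟩ := exists_calA_bound A hμ hB
  obtain ⟨CK, hCK0, hCK⟩ := exists_entry_bound K
  choose CT hCT0 hCT using fun k => exists_entry_bound (calT A k)
  set r : ℝ := (Fintype.card (Idx n m) : ℝ) with hr
  have hr0 : 0 ≤ r := by positivity
  have hS0 : 0 ≤ ∑ k, r * (r * CT k) :=
    Finset.sum_nonneg fun k _ => mul_nonneg hr0 (mul_nonneg hr0 (hCT0 k))
  refine ⟨r * (r * CA) + r * (r * CK) + ∑ k, r * (r * CT k) + r * (r * CK), by positivity,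
    fun τ y t δ hτ hy => ?_⟩
  have h0 := maxDelay_nonneg hh
  have hyt : ‖y t‖ ≤ δ := hy t ⟨by linarith, le_rfl⟩
  have hz : ‖(y t).1‖ ≤ δ := (norm_fst_le _).trans hyt
  have hu : ‖(y t).2‖ ≤ δ := (norm_snd_le _).trans hyt
  have hzk : ∀ k, ‖(y (t - τ k t)).1‖ ≤ δ := fun k =>
    (norm_fst_le _).trans <| hy _
      ⟨by linarith [(hτ k).2, le_maxDelay h k], by linarith [(hτ k).1]⟩
  have e : zRhs A B xbar K τ y t =
      WithLp.toLp 2 (calA A B (primalOf xbar (y t).1) *ᵥ (y t).1.ofLp) +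
      WithLp.toLp 2 (K *ᵥ (y t).1.ofLp) +
      ∑ k, WithLp.toLp 2 (calT A k *ᵥ (y (t - τ k t)).1.ofLp) -
      WithLp.toLp 2 (K *ᵥ (y t).2.ofLp) := by
    rw [zRhs, Matrix.add_mulVec, WithLp.toLp_sub, WithLp.toLp_add, WithLp.toLp_add,
      WithLp.toLp_sum]
  rw [e]
  have b1 := norm_toLp_mulVec_le (hCA (primalOf xbar (y t).1)) (y t).1
  have b2 := norm_toLp_mulVec_le hCK (y t).1
  have b3 := norm_toLp_mulVec_le hCK (y t).2
  have b4 : ‖∑ k, (WithLp.toLp 2 (calT A k *ᵥ (y (t - τ k t)).1.ofLp) : StateSpace n m)‖ ≤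
      (∑ k, r * (r * CT k)) * δ := by
    rw [Finset.sum_mul]
    refine norm_sum_le_of_le _ fun k _ => (norm_toLp_mulVec_le (hCT k) _).trans ?_
    exact mul_le_mul_of_nonneg_left (hzk k) (mul_nonneg hr0 (mul_nonneg hr0 (hCT0 k)))
  have m1 := mul_le_mul_of_nonneg_left hz (show 0 ≤ r * (r * CA) by positivity)
  have m2 := mul_le_mul_of_nonneg_left hz (show 0 ≤ r * (r * CK) by positivity)
  have m3 := mul_le_mul_of_nonneg_left hu (show 0 ≤ r * (r * CK) by positivity)
  refine (norm_sub_le _ _).trans ?_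
  have := norm_add₃_le (a := (WithLp.toLp 2 (calA A B (primalOf xbar (y t).1) *ᵥ (y t).1.ofLp) :
    StateSpace n m)) (b := WithLp.toLp 2 (K *ᵥ (y t).1.ofLp))
    (c := ∑ k, WithLp.toLp 2 (calT A k *ᵥ (y (t - τ k t)).1.ofLp))
  linarith

/-- Along the dynamics `B_i(x̂_i)` acts only on `x̃_i`, where it gives a difference of gradients.
Hence `z ↦ 𝒜(x̂) z` is continuous although the matrices `B_i` need not be. -/
theorem continuous_calA_mulVec (A : Blocks n m) {f : ∀ i, EuclideanSpace ℝ (Fin (n i)) → ℝ}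
    {μ ℓ : Fin N → ℝ} (hf : ∀ i, ContDiff ℝ 2 (f i)) {xbar : Primal n}
    {B : ∀ i, EuclideanSpace ℝ (Fin (n i)) → Matrix (Fin (n i)) (Fin (n i)) ℝ}
    (hB : ∀ i, IsSecantFamily (f i) (μ i) (ℓ i) (xbar i) (B i)) :
    Continuous fun z : StateSpace n m => calA A B (primalOf xbar z) *ᵥ z.ofLp := by
  have hg : ∀ i, Continuous (gradient (f i)) := fun i =>
    (InnerProductSpace.toDual ℝ (EuclideanSpace ℝ (Fin (n i)))).symm.continuous.comp
      ((hf i).continuous_fderiv (by norm_num))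
  have hx : ∀ i, Continuous fun z : StateSpace n m => primalOf xbar z i := fun i => by
    unfold primalOf
    fun_prop
  refine continuous_pi fun ⟨i, a⟩ => ?_
  simp only [calA, blockDiagonal'_mulVec_apply, localA, Matrix.fromBlocks_mulVec]
  rcases a with a | a
  · have e : ∀ z : StateSpace n m, B i (primalOf xbar z i) *ᵥ
        ((fun c => z.ofLp ⟨i, c⟩) ∘ Sum.inl) =
        (gradient (f i) (primalOf xbar z i) - gradient (f i) (xbar i)).ofLp := fun z => by
      rw [(hB i (primalOf xbar z i)).2.2.2]
      simp only [primalOf, add_sub_cancel_left]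
      rfl
    simp only [Sum.elim_inl, Pi.add_apply, Matrix.neg_mulVec, Pi.neg_apply, e]
    have h1 : Continuous fun z : StateSpace n m =>
        (gradient (f i) (primalOf xbar z i) - gradient (f i) (xbar i)).ofLp a := by
      have := (hg i).comp (hx i)
      have h2 : Continuous fun z : StateSpace n m =>
        (gradient (f i) (primalOf xbar z i) - gradient (f i) (xbar i)) := this.sub continuous_const
      fun_prop
    refine h1.neg.add (Continuous.neg ?_)
    simp only [Matrix.mulVec, dotProduct, Function.comp]
    fun_prop
  · simp only [Sum.elim_inr, Pi.add_apply, Matrix.mulVec, dotProduct, Function.comp]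
    fun_prop

end Bounds

/-! ### Solutions and growth bounds -/

section Solutions

variable {N : ℕ} {n m : Fin N → ℕ} {A : Blocks n m}
  {B : ∀ i, EuclideanSpace ℝ (Fin (n i)) → Matrix (Fin (n i)) (Fin (n i)) ℝ}
  {xbar : Primal n} {K : Matrix (Idx n m) (Idx n m) ℝ} {h : Edge A → ℝ} {τ : Edge A → ℝ → ℝ}
  {t₀ : ℝ} {y : ℝ → StateSpace n m × StateSpace n m}

theorem IsErrorSolution.intervalIntegrable_sub (hy : IsErrorSolution A B xbar K h τ t₀ y)
    (hh : ∀ k, 0 ≤ h k) {a b : ℝ} (ha : t₀ ≤ a) (hb : t₀ ≤ b) :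
    IntervalIntegrable (fun s => (y s).1 - (y s).2) volume a b := by
  have hc : ContinuousOn (fun s => (y s).1 - (y s).2) (Set.uIcc a b) := by
    have h1 : ContinuousOn y (Set.uIcc a b) := hy.cont.mono fun s hs => by
      have := (Set.uIcc_subset_Icc ⟨ha, le_max_left a b⟩ ⟨hb, le_max_right a b⟩ hs).1
      simp only [Set.mem_Ici]
      linarith [maxDelay_nonneg hh]
    exact h1.fst.sub h1.snd
  exact hc.intervalIntegrable

/-- A solution remains a solution when it is started at a later time. -/
theorem IsErrorSolution.shift (hy : IsErrorSolution A B xbar K h τ t₀ y)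
    (hh : ∀ k, 0 ≤ h k) {s : ℝ} (hs : t₀ ≤ s) :
    IsErrorSolution A B xbar K h τ s y := by
  have hint : ∀ t, s ≤ t → IntervalIntegrable (zRhs A B xbar K τ y) volume s t := fun t ht =>
    (hy.integrable t (hs.trans ht)).mono_set (by
      rw [Set.uIcc_of_le ht, Set.uIcc_of_le (hs.trans ht)]
      exact Set.Icc_subset_Icc_left hs)
  refine ⟨hy.cont.mono (Set.Ici_subset_Ici.mpr (by linarith)), hint, fun t ht => ?_,
    fun t ht => ?_⟩
  · rw [hy.z_eq t (hs.trans ht), hy.z_eq s hs, add_assoc,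
      intervalIntegral.integral_add_adjacent_intervals (hy.integrable s hs) (hint t ht)]
  · rw [hy.u_eq t (hs.trans ht), hy.u_eq s hs, add_assoc,
      intervalIntegral.integral_add_adjacent_intervals
        (hy.intervalIntegrable_sub hh le_rfl hs)
        (hy.intervalIntegrable_sub hh hs (hs.trans ht))]

/-- The velocity `ż` of a solution with initial time `t₀`, set to zero before `t₀`. -/
def velocity (A : Blocks n m)
    (B : ∀ i, EuclideanSpace ℝ (Fin (n i)) → Matrix (Fin (n i)) (Fin (n i)) ℝ)
    (xbar : Primal n) (K : Matrix (Idx n m) (Idx n m) ℝ)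
    (τ : Edge A → ℝ → ℝ) (t₀ : ℝ) (y : ℝ → StateSpace n m × StateSpace n m) :
    ℝ → StateSpace n m :=
  (Set.Ici t₀).indicator (zRhs A B xbar K τ y)

theorem IsErrorSolution.velocity_integrable (hy : IsErrorSolution A B xbar K h τ t₀ y) (a b : ℝ) :
    IntervalIntegrable (velocity A B xbar K τ t₀ y) volume a b := by
  rw [intervalIntegrable_iff]
  rw [velocity, IntegrableOn, integrable_indicator_iff measurableSet_Ici, IntegrableOn,
    Measure.restrict_restrict measurableSet_Ici]
  have h1 := (intervalIntegrable_iff_integrableOn_Icc_of_le (le_max_left t₀ (max a b))).mp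
    (hy.integrable (max t₀ (max a b)) (le_max_left _ _))
  refine IntegrableOn.mono_set h1 fun s hs => ⟨hs.1, le_max_of_le_right ?_⟩
  exact hs.2.2

theorem IsErrorSolution.z_eq_velocity (hy : IsErrorSolution A B xbar K h τ t₀ y)
    {a b : ℝ} (ha : t₀ ≤ a) (hb : t₀ ≤ b) :
    (y b).1 = (y a).1 + ∫ s in a..b, velocity A B xbar K τ t₀ y s := by
  have e : ∀ t, t₀ ≤ t → (y t).1 = (y t₀).1 + ∫ s in t₀..t, velocity A B xbar K τ t₀ y s :=
    fun t ht => by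
      rw [hy.z_eq t ht]
      congr 1
      refine intervalIntegral.integral_congr fun s hs => ?_
      rw [Set.uIcc_of_le ht] at hs
      exact (Set.indicator_of_mem (show s ∈ Set.Ici t₀ from hs.1) _).symm
  rw [e b hb, e a ha, add_assoc, intervalIntegral.integral_add_adjacent_intervals
    (hy.velocity_integrable _ _) (hy.velocity_integrable _ _)]

theorem IsErrorSolution.u_eq_integral (hy : IsErrorSolution A B xbar K h τ t₀ y)
    (hh : ∀ k, 0 ≤ h k) {a b : ℝ} (ha : t₀ ≤ a) (hb : t₀ ≤ b) :
    (y b).2 = (y a).2 + ∫ s in a..b, ((y s).1 - (y s).2) := by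
  rw [hy.u_eq b hb, hy.u_eq a ha, add_assoc, intervalIntegral.integral_add_adjacent_intervals
    (hy.intervalIntegrable_sub hh le_rfl ha) (hy.intervalIntegrable_sub hh ha hb)]

/-- Making a solution constant before its memory window gives a solution that is continuous
on `ℝ`. -/
theorem IsErrorSolution.exists_continuous (hy : IsErrorSolution A B xbar K h τ t₀ y)
    (ht₀ : 0 ≤ t₀) (hh : ∀ k, 0 ≤ h k) (hτ : ∀ k t, 0 ≤ t → τ k t ∈ Set.Icc 0 (h k)) :
    ∃ y', Continuous y' ∧ IsErrorSolution A B xbar K h τ t₀ y' ∧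
      ∀ t, t₀ - maxDelay h ≤ t → y' t = y t := by
  have h0 := maxDelay_nonneg hh
  set y' : ℝ → StateSpace n m × StateSpace n m := fun t => y (max t (t₀ - maxDelay h)) with hy'
  have e : ∀ t, t₀ - maxDelay h ≤ t → y' t = y t := fun t ht => by rw [hy']; simp [max_eq_left ht]
  have hc : Continuous y' :=
    hy.cont.comp_continuous (by fun_prop) fun t =>
      Set.mem_Ici.mpr (le_max_right _ _)
  have er : ∀ t, t₀ ≤ t → zRhs A B xbar K τ y' t = zRhs A B xbar K τ y t := fun t ht => by
    have hk : ∀ k, y' (t - τ k t) = y (t - τ k t) := fun k => e _ (by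
      linarith [(hτ k t (ht₀.trans ht)).2, le_maxDelay h k])
    simp only [zRhs, hk, e t (by linarith)]
  refine ⟨y', hc, ⟨hc.continuousOn, fun t ht => ?_, fun t ht => ?_, fun t ht => ?_⟩, e⟩
  · refine (intervalIntegrable_congr fun s hs => ?_).mp (hy.integrable t ht)
    rw [Set.uIoc_of_le ht] at hs
    exact (er s hs.1.le).symm
  · rw [e t (by linarith), e t₀ (by linarith), hy.z_eq t ht]
    congr 1
    refine intervalIntegral.integral_congr fun s hs => ?_
    rw [Set.uIcc_of_le ht] at hs
    exact (er s hs.1).symm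
  · rw [e t (by linarith), e t₀ (by linarith), hy.u_eq t ht]
    congr 1
    refine intervalIntegral.integral_congr fun s hs => ?_
    rw [Set.uIcc_of_le ht] at hs
    simp only [e s (by linarith [hs.1])]

/-- Exponential growth bound (Gronwall's inequality with memory), by considering the first time at
which the solution reaches the bound. -/
theorem norm_le_exp_of_memory_bound {E : Type} [NormedAddCommGroup E] [NormedSpace ℝ E]
    {y : ℝ → E × E} {p q : ℝ → E} {r t₀ L δ : ℝ} (hr : 0 ≤ r) (hL : 0 < L) (hδ : 0 < δ)
    (hy : Continuous y)
    (hp : ∀ t, t₀ ≤ t → ∀ c, (∀ s ∈ Set.Icc (t - r) t, ‖y s‖ ≤ c) → ‖p t‖ ≤ L * c ∧ ‖q t‖ ≤ L * c)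
    (hz : ∀ t, t₀ ≤ t → (y t).1 = (y t₀).1 + ∫ s in t₀..t, p s)
    (hu : ∀ t, t₀ ≤ t → (y t).2 = (y t₀).2 + ∫ s in t₀..t, q s)
    (hw : ∀ s ∈ Set.Icc (t₀ - r) t₀, ‖y s‖ ≤ δ) {t : ℝ} (ht : t₀ ≤ t) :
    ‖y t‖ ≤ 2 * δ * Real.exp (L * (t - t₀)) := by
  set φ : ℝ → ℝ := fun s => 2 * δ * Real.exp (L * (s - t₀)) with hφ
  have hφc : Continuous φ := by fun_prop
  have hφm : Monotone φ := fun a b hab => by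
    simp only [hφ]
    gcongr
  have hφ0 : φ t₀ = 2 * δ := by simp [hφ]
  by_contra! hcon
  have hcomp : IsCompact ({s | φ s ≤ ‖y s‖} ∩ Set.Icc t₀ t) :=
    isCompact_Icc.inter_left (isClosed_le hφc hy.norm)
  obtain ⟨T, ⟨hT1, hT2⟩, hT3⟩ := hcomp.exists_isLeast ⟨t, hcon.le, ht, le_rfl⟩
  have hbefore : ∀ s, t₀ - r ≤ s → s < T → ∀ s', s ≤ s' → t₀ ≤ s' → ‖y s‖ ≤ φ s' := by
    intro s hs1 hs2 s' hs' hs'0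
    by_cases hst : t₀ ≤ s
    · refine le_trans ?_ (hφm hs')
      by_contra! hlt
      exact absurd (hT3 ⟨hlt.le, hst, hs2.le.trans hT2.2⟩) (not_le.mpr hs2)
    · have := hw s ⟨hs1, (not_le.mp hst).le⟩
      have := hφm hs'0
      linarith
  have hpq : ∀ s, t₀ ≤ s → s < T → ‖p s‖ ≤ L * φ s ∧ ‖q s‖ ≤ L * φ s := fun s hs hsT =>
    hp s hs (φ s) fun s' hs' =>
      hbefore s' (by linarith [hs'.1]) (hs'.2.trans_lt hsT) s hs'.2 hs
  have hint : ∫ s in t₀..T, L * φ s = φ T - φ t₀ := by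
    refine intervalIntegral.integral_eq_sub_of_hasDerivAt (fun s _ => ?_)
      ((hφc.const_mul L).intervalIntegrable _ _)
    have h1 : HasDerivAt (fun s => L * (s - t₀)) L s := by
      simpa using ((hasDerivAt_id s).sub_const t₀).const_mul L
    have h2 := h1.exp.const_mul (2 * δ)
    exact h2.congr_deriv (by simp only [hφ]; ring)
  have hlt : ∀ {v : ℝ → E} {x x₀ : E}, (∀ s, t₀ ≤ s → s < T → ‖v s‖ ≤ L * φ s) → ‖x₀‖ ≤ δ →
      x = x₀ + ∫ s in t₀..T, v s → ‖x‖ < φ T := by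
    intro v x x₀ hv hx₀ hx
    have : ‖∫ s in t₀..T, v s‖ ≤ ∫ s in t₀..T, L * φ s := by
      refine intervalIntegral.norm_integral_le_of_norm_le hT2.1 ?_
        ((hφc.const_mul L).intervalIntegrable _ _)
      filter_upwards [Measure.ae_ne volume T] with s hs hs'
      exact hv s hs'.1.le (lt_of_le_of_ne hs'.2 hs)
    rw [hint, hφ0] at this
    rw [hx]
    linarith [norm_add_le x₀ (∫ s in t₀..T, v s)]
  have h0 := hw t₀ ⟨by linarith, le_rfl⟩
  have hz' := hlt (fun s h1 h2 => (hpq s h1 h2).1) ((norm_fst_le _).trans h0) (hz T hT2.1)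
  have hu' := hlt (fun s h1 h2 => (hpq s h1 h2).2) ((norm_snd_le _).trans h0) (hu T hT2.1)
  have hT1' : φ T ≤ ‖y T‖ := hT1
  exact absurd hT1' (not_le.mpr (max_lt hz' hu'))

end Solutions

section Coercivity

theorem exists_coercive_of_pos {E : Type} [NormedAddCommGroup E] [NormedSpace ℝ E]
    [ProperSpace E] {q : E → ℝ} (hq : Continuous q) (hs : ∀ (c : ℝ) x, q (c • x) = c ^ 2 * q x)
    (hpos : ∀ x, x ≠ 0 → 0 < q x) : ∃ c > 0, ∀ x, c * ‖x‖ ^ 2 ≤ q x := by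
  have h00 : q 0 = 0 := by simpa using hs 0 0
  rcases (Metric.sphere (0 : E) 1).eq_empty_or_nonempty with he | hne
  · refine ⟨1, one_pos, fun x => ?_⟩
    by_cases hx : x = 0
    · simp [hx, h00]
    · have : ‖x‖⁻¹ • x ∈ Metric.sphere (0 : E) 1 := by
        simp [norm_smul, hx]
      rw [he] at this
      exact this.elim
  · obtain ⟨v, hv, hmin⟩ := (isCompact_sphere (0 : E) 1).exists_isMinOn hne hq.continuousOn
    refine ⟨q v, hpos v fun h0 => by simp [h0] at hv, fun x => ?_⟩
    by_cases hx : x = 0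
    · simp [hx, h00]
    · have hx' : ‖x‖ ≠ 0 := norm_ne_zero_iff.mpr hx
      have h1 : ‖x‖⁻¹ • x ∈ Metric.sphere (0 : E) 1 := by
        simp [norm_smul, hx]
      have h2 := isMinOn_iff.mp hmin _ h1
      rw [hs] at h2
      calc q v * ‖x‖ ^ 2 ≤ (‖x‖⁻¹ ^ 2 * q x) * ‖x‖ ^ 2 := by gcongr
        _ = q x := by field_simp

theorem exists_abs_bil_le {ι : Type} [Fintype ι] (M : Matrix ι ι ℝ) :
    ∃ C, 0 ≤ C ∧ ∀ (x y : ι → ℝ) (δ : ℝ), (∀ i, |x i| ≤ δ) → (∀ i, |y i| ≤ δ) →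
      |bil M x y| ≤ C * δ ^ 2 := by
  refine ⟨∑ i, ∑ j, |M i j|, by positivity, fun x y δ hx hy => ?_⟩
  rw [bil_apply, Finset.sum_mul]
  refine (Finset.abs_sum_le_sum_abs _ _).trans (Finset.sum_le_sum fun i _ => ?_)
  rw [Finset.sum_mul]
  refine (Finset.abs_sum_le_sum_abs _ _).trans (Finset.sum_le_sum fun j _ => ?_)
  rw [abs_mul, abs_mul, sq]
  have := mul_le_mul (hx i) (hy j) (abs_nonneg _) ((abs_nonneg _).trans (hx i))
  gcongr

variable {N : ℕ} {n m : Fin N → ℕ} {A : Blocks n m}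

/-- On bounded sets away from `(z, u) = 0` the quadratic form of `Φ`, evaluated along the
dynamics, is bounded away from zero: it is a continuous function there. No uniformity of
`Φ(x̂) < 0` in `x̂` is needed. -/
theorem exists_dissipation_le {f : ∀ i, EuclideanSpace ℝ (Fin (n i)) → ℝ}
    {μ ℓ : Fin N → ℝ} (hf : ∀ i, ContDiff ℝ 2 (f i)) {xbar : Primal n}
    {B : ∀ i, EuclideanSpace ℝ (Fin (n i)) → Matrix (Fin (n i)) (Fin (n i)) ℝ}
    (hB : ∀ i, IsSecantFamily (f i) (μ i) (ℓ i) (xbar i) (B i))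
    {D : Vars A} {ε : ℝ} {h d : Edge A → ℝ} (hD : D.Feasible B ε h d) {r : ℝ} (hr : 0 < r)
    (M : ℝ) :
    ∃ c > 0, ∀ (y : StateSpace n m × StateSpace n m) (p : StateSpace n m)
      (a b : Edge A → StateSpace n m), r ≤ ‖y‖ → ‖y‖ ≤ M → ‖p‖ ≤ M → (∀ k, ‖a k‖ ≤ M) →
      (∀ k, ‖b k‖ ≤ M) →
      dissipation D ε h d y.2 y.1 p (fun k => a k) (fun k => b k)
        (calA A B (primalOf xbar y.1) *ᵥ y.1.ofLp) ≤ -c := by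
  let V := (StateSpace n m × StateSpace n m) × StateSpace n m × (Edge A → StateSpace n m) ×
    (Edge A → StateSpace n m)
  let Ψ : V → ℝ := fun v => dissipation D ε h d v.1.2 v.1.1 v.2.1 (fun k => v.2.2.1 k)
    (fun k => v.2.2.2 k) (calA A B (primalOf xbar v.1.1) *ᵥ v.1.1.ofLp)
  have hΨ : Continuous Ψ := by
    have hg : Continuous fun v : V => calA A B (primalOf xbar v.1.1) *ᵥ v.1.1.ofLp :=
      (continuous_calA_mulVec A hf hB).comp (by fun_prop)
    have hT : ∀ k, Continuous fun v : V => calT A k *ᵥ (v.2.2.2 k).ofLp := fun k =>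
      Continuous.matrix_mulVec continuous_const (by fun_prop)
    have c1 : Continuous fun v : V => v.1.1.ofLp := by fun_prop
    have c2 : Continuous fun v : V => v.1.2.ofLp := by fun_prop
    have c3 : Continuous fun v : V => v.2.1.ofLp := by fun_prop
    have c4 : ∀ k, Continuous fun v : V => (v.2.2.1 k).ofLp := fun k => by fun_prop
    have c5 : ∀ k, Continuous fun v : V => (v.2.2.2 k).ofLp := fun k => by fun_prop
    have c6 : Continuous fun v : V => v.1.1.ofLp + ε • v.2.1.ofLp := c1.add (c3.const_smul ε)
    have c7 : Continuous fun v : V => calA A B (primalOf xbar v.1.1) *ᵥ v.1.1.ofLp +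
        ∑ k, calT A k *ᵥ (v.2.2.2 k).ofLp - v.2.1.ofLp :=
      (hg.add (continuous_finsetSum _ fun k _ => hT k)).sub c3
    refine ((((continuous_bil _ c1 c3).add (continuous_bil _ c3 c2)).add
      (continuous_bil _ c1 (c1.sub c2))).add (continuous_bil _ c2 (c1.sub c2))).const_mul 2
      |>.add (((continuous_bil _ c6 c7).add (continuous_bil _ c6 (c1.sub c2))).const_mul 2)
      |>.add (continuous_finsetSum _ fun k _ => ?_)
    exact ((((continuous_bil _ c1 c1).sub (continuous_bil _ (c4 k) (c4 k))).add
      ((continuous_bil _ c1 c1).sub ((continuous_bil _ (c5 k) (c5 k)).const_mul _))).add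
      ((continuous_bil _ c3 c3).const_mul _)).sub
      (((continuous_bil _ (c1.sub (c5 k)) (c1.sub (c5 k))).add
      ((continuous_bil _ (c1.sub (c5 k)) ((c5 k).sub (c4 k))).const_mul 2)).add
      (continuous_bil _ ((c5 k).sub (c4 k)) ((c5 k).sub (c4 k))))
  have hK : IsCompact ({v : V | r ≤ ‖v.1‖} ∩ Metric.closedBall 0 M) :=
    (isCompact_closedBall _ _).inter_left (isClosed_le continuous_const (by fun_prop))
  have hmem : ∀ (y : StateSpace n m × StateSpace n m) (p : StateSpace n m)
      (a b : Edge A → StateSpace n m), r ≤ ‖y‖ → ‖y‖ ≤ M → ‖p‖ ≤ M → (∀ k, ‖a k‖ ≤ M) →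
      (∀ k, ‖b k‖ ≤ M) → ((y, p, a, b) : V) ∈ {v : V | r ≤ ‖v.1‖} ∩ Metric.closedBall 0 M := by
    intro y p a b hry hy hp ha hb
    have hM : 0 ≤ M := hr.le.trans (hry.trans hy)
    refine ⟨hry, mem_closedBall_zero_iff.mpr ?_⟩
    exact max_le hy (max_le hp (max_le ((pi_norm_le_iff_of_nonneg hM).mpr ha)
      ((pi_norm_le_iff_of_nonneg hM).mpr hb)))
  rcases ({v : V | r ≤ ‖v.1‖} ∩ Metric.closedBall 0 M).eq_empty_or_nonempty with he | hne
  · refine ⟨1, one_pos, fun y p a b hry hy hp ha hb => ?_⟩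
    have := hmem y p a b hry hy hp ha hb
    rw [he] at this
    exact this.elim
  · obtain ⟨v, hv, hmax⟩ := hK.exists_isMaxOn hne hΨ.continuousOn
    refine ⟨-Ψ v, ?_, fun y p a b hry hy hp ha hb => ?_⟩
    · have h1 : ¬(v.1.1.ofLp = 0 ∧ v.1.2.ofLp = 0) := by
        rintro ⟨h1, h2⟩
        have h3 : r ≤ ‖v.1‖ := hv.1
        have : v.1 = 0 := Prod.ext ((WithLp.ofLp_eq_zero 2).mp h1) ((WithLp.ofLp_eq_zero 2).mp h2)
        rw [this, norm_zero] at h3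
        linarith
      have := dissipation_neg hD (primalOf xbar v.1.1) v.2.1 (fun k => v.2.2.1 k)
        (fun k => v.2.2.2 k) h1
      exact neg_pos.mpr this
    · rw [neg_neg]
      have := isMaxOn_iff.mp hmax (y, p, a, b) (hmem y p a b hry hy hp ha hb)
      exact this

end Coercivity

/-! ### The functional along solutions -/

section Functional

variable {N : ℕ} {n m : Fin N → ℕ} {A : Blocks n m}
  {B : ∀ i, EuclideanSpace ℝ (Fin (n i)) → Matrix (Fin (n i)) (Fin (n i)) ℝ}
  {xbar : Primal n} {K : Matrix (Idx n m) (Idx n m) ℝ} {h : Edge A → ℝ} {τ : Edge A → ℝ → ℝ}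
  {t₀ : ℝ} {y : ℝ → StateSpace n m × StateSpace n m}

/-- There is a functional `W` of the trajectory whose growth is at most the integral of `W'`, where
`W'` is bounded by the `Q_k` terms of the matrix `Φ`. For delays with a bounded rate it is
`∑ₖ ∫_{t-τₖ(t)}^t zᵀ Q_k z`, for delays without such a bound it is zero. The constant `C` may not
depend on the initial time or on the trajectory. -/
def HasDelayEnergy (D : Vars A) (h d : Edge A → ℝ) (τ : Edge A → ℝ → ℝ) : Prop :=
  ∃ C, 0 ≤ C ∧ ∀ t₀, 0 ≤ t₀ → ∀ z : ℝ → Idx n m → ℝ, Continuous z → ∃ W W' : ℝ → ℝ,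
    (∀ t, t₀ ≤ t → 0 ≤ W t) ∧
    (∀ t δ, t₀ ≤ t → (∀ s ∈ Set.Icc (t - maxDelay h) t, ∀ i, |z s i| ≤ δ) → W t ≤ C * δ ^ 2) ∧
    (∀ a b, t₀ ≤ a → a ≤ b → IntervalIntegrable W' volume a b ∧ W b - W a ≤ ∫ t in a..b, W' t) ∧
    ∀ t, t₀ ≤ t → W' t ≤ ∑ k, (bil (D.Q k) (z t) (z t) -
      (1 - d k) * bil (D.Q k) (z (t - τ k t)) (z (t - τ k t)))

theorem hasDelayEnergy_of_nonneg {D : Vars A} {h d : Edge A → ℝ} {τ : Edge A → ℝ → ℝ}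
    (hQ : ∀ k x x', 0 ≤ bil (D.Q k) x x - (1 - d k) * bil (D.Q k) x' x') :
    HasDelayEnergy D h d τ := by
  refine ⟨0, le_rfl, fun t₀ _ z _ =>
    ⟨fun _ => 0, fun _ => 0, ?_, ?_, ?_, ?_⟩⟩
  · simp
  · simp
  · intro a b _ _
    exact ⟨intervalIntegrable_const, by simp⟩
  · intro t _
    exact Finset.sum_nonneg fun k _ => hQ k _ _

theorem SlowDelays.hasDelayEnergy {D : Vars A} {h d : Edge A → ℝ} {τ : Edge A → ℝ → ℝ}
    (hτ : SlowDelays h d τ) (hQ : ∀ k, (D.Q k).PosSemidef) (hh : ∀ k, 0 ≤ h k) :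
    HasDelayEnergy D h d τ := by
  choose CQ hCQ0 hCQ using fun k => exists_abs_bil_le (D.Q k)
  refine ⟨∑ k, h k * CQ k, Finset.sum_nonneg fun k _ => mul_nonneg (hh k) (hCQ0 k),
    fun t₀ ht₀ z hz => ?_⟩
  set q : Edge A → ℝ → ℝ := fun k s => bil (D.Q k) (z s) (z s) with hq
  have hqc : ∀ k, Continuous (q k) := fun k => continuous_bil _ hz hz
  have hq0 : ∀ k s, 0 ≤ q k s := fun k s => bil_self_nonneg (hQ k) _
  -- The delays are extended to negative times by their value at `0`.
  set σ : Edge A → ℝ → ℝ := fun k t => τ k (max t 0) with hσ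
  have hσc : ∀ k, Continuous (σ k) := fun k =>
    (hτ.diff k).continuousOn.comp_continuous (by fun_prop) fun t =>
      Set.mem_Ici.mpr (le_max_right _ _)
  have hστ : ∀ k t, 0 ≤ t → σ k t = τ k t := fun k t ht => by simp [hσ, max_eq_left ht]
  set w' : Edge A → ℝ → ℝ := fun k t => q k t - (1 - d k) * q k (t - σ k t) with hw'
  have hwc : ∀ k, Continuous (w' k) := fun k =>
    (hqc k).sub (((hqc k).comp (continuous_id.sub (hσc k))).const_mul _)
  have key : ∀ k a b, 0 ≤ a → a ≤ b →
      (∫ s in (b - σ k b)..b, q k s) - (∫ s in (a - σ k a)..a, q k s) ≤ ∫ t in a..b, w' k t := by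
    intro k a b ha hab
    set G : ℝ → ℝ := fun t => ∫ s in (0 : ℝ)..t, q k s with hG
    have hGd : ∀ t, HasDerivAt G (q k t) t := fun t => (hqc k).integral_hasStrictDerivAt 0 t
      |>.hasDerivAt
    have hGe : ∀ a b, ∫ s in a..b, q k s = G b - G a := fun a b =>
      (intervalIntegral.integral_interval_sub_left ((hqc k).intervalIntegrable _ _)
        ((hqc k).intervalIntegrable _ _)).symm
    set H : ℝ → ℝ := fun t => G t - G (t - σ k t) - ∫ s in (0 : ℝ)..t, w' k s with hH
    have hGc : Continuous G := continuous_iff_continuousAt.mpr fun t => (hGd t).continuousAt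
    have hHc : Continuous H :=
      (hGc.sub (hGc.comp (continuous_id.sub (hσc k)))).sub
        (intervalIntegral.continuous_primitive (fun a b => (hwc k).intervalIntegrable a b) 0)
    have hHd : ∀ t, 0 < t → HasDerivAt H
        ((derivWithin (τ k) (Set.Ici 0) t - d k) * q k (t - σ k t)) t := by
      intro t ht
      have hτd : HasDerivAt (τ k) (derivWithin (τ k) (Set.Ici 0) t) t :=
        ((hτ.diff k t ht.le).hasDerivWithinAt).hasDerivAt (Ici_mem_nhds ht)
      have hσd : HasDerivAt (σ k) (derivWithin (τ k) (Set.Ici 0) t) t :=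
        hτd.congr_of_eventuallyEq <| by
          filter_upwards [Ici_mem_nhds ht] with s hs using hστ k s hs
      have h1 := (hGd (t - σ k t)).comp t ((hasDerivAt_id t).sub hσd)
      have h2 : HasDerivAt (fun t => ∫ s in (0 : ℝ)..t, w' k s) (w' k t) t :=
        ((hwc k).integral_hasStrictDerivAt 0 t).hasDerivAt
      refine (((hGd t).sub h1).sub h2).congr_deriv ?_
      simp only [hw']
      ring
    have hanti : AntitoneOn H (Set.Icc a b) := by
      refine antitoneOn_of_deriv_nonpos (convex_Icc a b) hHc.continuousOn ?_ ?_
      · intro t ht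
        rw [interior_Icc] at ht
        exact (hHd t (ha.trans_lt ht.1)).differentiableAt.differentiableWithinAt
      · intro t ht
        rw [interior_Icc] at ht
        have ht0 : 0 < t := ha.trans_lt ht.1
        rw [(hHd t ht0).deriv]
        refine mul_nonpos_of_nonpos_of_nonneg ?_ (hq0 _ _)
        have := (abs_le.mp (hτ.rate k t ht0.le)).2
        linarith
    have := hanti ⟨le_rfl, hab⟩ ⟨hab, le_rfl⟩ hab
    have e : ∫ t in a..b, w' k t = (∫ s in (0 : ℝ)..b, w' k s) - ∫ s in (0 : ℝ)..a, w' k s :=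
      (intervalIntegral.integral_interval_sub_left ((hwc k).intervalIntegrable _ _)
        ((hwc k).intervalIntegrable _ _)).symm
    simp only [hH] at this
    rw [hGe, hGe, e]
    linarith
  refine ⟨fun t => ∑ k, ∫ s in (t - σ k t)..t, q k s, fun t => ∑ k, w' k t, fun t ht => ?_,
    fun t δ ht hδ => ?_, fun a b ha hab => ?_, fun t ht => ?_⟩
  · refine Finset.sum_nonneg fun k _ => intervalIntegral.integral_nonneg ?_ fun s _ => hq0 k s
    rw [hστ k t (ht₀.trans ht)]
    linarith [(hτ.range k t (ht₀.trans ht)).1]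
  · rw [Finset.sum_mul]
    refine Finset.sum_le_sum fun k _ => ?_
    have hr := hτ.range k t (ht₀.trans ht)
    rw [hστ k t (ht₀.trans ht)]
    have h1 : ∫ s in (t - τ k t)..t, q k s ≤ ∫ _ in (t - τ k t)..t, CQ k * δ ^ 2 := by
      refine intervalIntegral.integral_mono_on (by linarith [hr.1])
        ((hqc k).intervalIntegrable _ _) (by simp) fun s hs => ?_
      have hs' := hδ s ⟨by linarith [hs.1, hr.2, le_maxDelay h k], hs.2⟩
      exact (le_abs_self _).trans (hCQ k _ _ _ hs' hs')
    rw [intervalIntegral.integral_const, smul_eq_mul] at h1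
    have h2 : τ k t * (CQ k * δ ^ 2) ≤ h k * (CQ k * δ ^ 2) :=
      mul_le_mul_of_nonneg_right hr.2 (mul_nonneg (hCQ0 k) (sq_nonneg δ))
    linarith
  · refine ⟨intervalIntegrable_finsetSum _ fun k _ => (hwc k).intervalIntegrable _ _, ?_⟩
    rw [intervalIntegral.integral_finsetSum fun k _ => (hwc k).intervalIntegrable _ _,
      ← Finset.sum_sub_distrib]
    exact Finset.sum_le_sum fun k _ => key k a b (ht₀.trans ha) hab
  · simp only [hw', hq, hστ _ t (ht₀.trans ht)]
    exact le_rfl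

theorem IsErrorSolution.velocity_apply_integrable (hy : IsErrorSolution A B xbar K h τ t₀ y)
    (i : Idx n m) (a b : ℝ) :
    IntervalIntegrable (fun t => velocity A B xbar K τ t₀ y t i) volume a b := by
  have := hy.velocity_integrable a b
  rw [intervalIntegrable_iff] at this ⊢
  exact (EuclideanSpace.proj (𝕜 := ℝ) i).integrable_comp this

theorem IsErrorSolution.z_eq_velocity_apply (hy : IsErrorSolution A B xbar K h τ t₀ y)
    {a b : ℝ} (ha : t₀ ≤ a) (hb : t₀ ≤ b) (i : Idx n m) :
    (y b).1 i = (y a).1 i + ∫ s in a..b, velocity A B xbar K τ t₀ y s i := by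
  have h1 : ∫ s in a..b, velocity A B xbar K τ t₀ y s i =
      (∫ s in a..b, velocity A B xbar K τ t₀ y s) i :=
    (EuclideanSpace.proj (𝕜 := ℝ) i).intervalIntegral_comp_comm (hy.velocity_integrable a b)
  rw [h1, hy.z_eq_velocity ha hb]
  rfl

theorem IsErrorSolution.u_eq_integral_apply (hy : IsErrorSolution A B xbar K h τ t₀ y)
    (hh : ∀ k, 0 ≤ h k) {a b : ℝ} (ha : t₀ ≤ a) (hb : t₀ ≤ b) (i : Idx n m) :
    (y b).2 i = (y a).2 i + ∫ s in a..b, ((y s).1 i - (y s).2 i) := by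
  have h1 : ∫ s in a..b, ((y s).1 i - (y s).2 i) = (∫ s in a..b, ((y s).1 - (y s).2)) i :=
    (EuclideanSpace.proj (𝕜 := ℝ) i).intervalIntegral_comp_comm
      (hy.intervalIntegrable_sub hh ha hb)
  rw [h1, hy.u_eq_integral hh ha hb]
  rfl

theorem norm_velocity_le {L : ℝ} (hL0 : 0 ≤ L)
    (hL : ∀ t, 0 ≤ t → ∀ δ, (∀ s ∈ Set.Icc (t - maxDelay h) t, ‖y s‖ ≤ δ) →
      ‖zRhs A B xbar K τ y t‖ ≤ L * δ) (ht₀ : 0 ≤ t₀) (hh : ∀ k, 0 ≤ h k) {t δ : ℝ}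
    (hw : ∀ s ∈ Set.Icc (t - maxDelay h) t, ‖y s‖ ≤ δ) :
    ‖velocity A B xbar K τ t₀ y t‖ ≤ L * δ := by
  by_cases ht : t₀ ≤ t
  · rw [velocity, Set.indicator_of_mem (show t ∈ Set.Ici t₀ from ht)]
    exact hL t (ht₀.trans ht) δ hw
  · rw [velocity, Set.indicator_of_notMem (show t ∉ Set.Ici t₀ from ht), norm_zero]
    have := hw t ⟨by linarith [maxDelay_nonneg hh], le_rfl⟩
    exact mul_nonneg hL0 ((norm_nonneg _).trans this)

theorem IsErrorSolution.bil_velocity_integrable (hy : IsErrorSolution A B xbar K h τ t₀ y)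
    (hc : Continuous y) {L : ℝ}
    (hL : ∀ t δ, (∀ s ∈ Set.Icc (t - maxDelay h) t, ‖y s‖ ≤ δ) →
      ‖velocity A B xbar K τ t₀ y t‖ ≤ L * δ) (M : Matrix (Idx n m) (Idx n m) ℝ) (a b : ℝ) :
    IntervalIntegrable (fun t => bil M (velocity A B xbar K τ t₀ y t)
      (velocity A B xbar K τ t₀ y t)) volume a b := by
  obtain ⟨C, hC⟩ := (isCompact_Icc (a := min a b - maxDelay h)
    (b := max a b)).exists_bound_of_continuousOn hc.continuousOn
  have hb : ∀ t ∈ Set.uIoc a b, ‖velocity A B xbar K τ t₀ y t‖ ≤ L * C := fun t ht =>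
    hL t C fun s hs => hC s ⟨by linarith [hs.1, ht.1], hs.2.trans ht.2⟩
  simp only [bil_apply]
  refine intervalIntegrable_finsetSum _ fun i _ => intervalIntegrable_finsetSum _ fun j _ =>
    IntervalIntegrable.const_mul ?_ _
  have hi := hy.velocity_apply_integrable i a b
  have hj := hy.velocity_apply_integrable j a b
  rw [intervalIntegrable_iff] at hi hj ⊢
  refine Integrable.bdd_mul (c := L * C) hj hi.aestronglyMeasurable ?_
  filter_upwards [ae_restrict_mem measurableSet_uIoc] with t ht
  exact (PiLp.norm_apply_le _ i).trans (hb t ht)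

/-- The Lyapunov–Krasovskii functional along a solution. It is used from time `t₀ + h` on, when the
memory window no longer contains the initial function, which need not be differentiable. -/
theorem exists_functional {f : ∀ i, EuclideanSpace ℝ (Fin (n i)) → ℝ} {μ ℓ : Fin N → ℝ}
    (hμ : ∀ i, 0 < μ i) (hB : ∀ i, IsSecantFamily (f i) (μ i) (ℓ i) (xbar i) (B i))
    (hh : ∀ k, 0 ≤ h k) {D : Vars A} {ε : ℝ} {d : Edge A → ℝ} (hD : D.Feasible B ε h d)
    (hτ : ∀ k t, 0 ≤ t → τ k t ∈ Set.Icc 0 (h k)) (hQ : HasDelayEnergy D h d τ) :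
    ∃ c₀ > 0, ∃ C, 0 ≤ C ∧ ∀ t₀, 0 ≤ t₀ → ∀ y, Continuous y →
      IsErrorSolution A B xbar D.gain h τ t₀ y → ∃ V V' : ℝ → ℝ,
        (∀ t, t₀ + maxDelay h ≤ t → c₀ * ‖y t‖ ^ 2 ≤ V t) ∧
        (∀ δ, (∀ s ∈ Set.Icc (t₀ - maxDelay h) (t₀ + maxDelay h), ‖y s‖ ≤ δ) →
          V (t₀ + maxDelay h) ≤ C * δ ^ 2) ∧
        (∀ a b, t₀ + maxDelay h ≤ a → a ≤ b →
          IntervalIntegrable V' volume a b ∧ V b - V a ≤ ∫ t in a..b, V' t) ∧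
        ∀ t, t₀ + maxDelay h ≤ t → V' t ≤ dissipation D ε h d (y t).2 (y t).1
          (zRhs A B xbar D.gain τ y t) (fun k => (y (t - h k)).1) (fun k => (y (t - τ k t)).1)
          (calA A B (primalOf xbar (y t).1) *ᵥ (y t).1.ofLp) := by
  obtain ⟨L, hL0, hL⟩ := exists_zRhs_bound A hμ hB D.gain hh
  obtain ⟨CQ, hCQ0, hCQ⟩ := hQ
  obtain ⟨CY, hCY0, hCY⟩ := exists_abs_bil_le (symBlock D.Y11 D.Y12 D.Y22)
  choose CS hCS0 hCS using fun k => exists_abs_bil_le (D.S k)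
  choose CR hCR0 hCR using fun k => exists_abs_bil_le (D.R k)
  have hm0 := maxDelay_nonneg hh
  have hYs : (symBlock D.Y11 D.Y12 D.Y22).IsSymm := by simpa using hD.Y_pos.isHermitian
  obtain ⟨c₀, hc₀, hcoer⟩ := exists_coercive_of_pos
    (q := fun v : StateSpace n m × StateSpace n m => bil (symBlock D.Y11 D.Y12 D.Y22)
      (Sum.elim v.1 v.2) (Sum.elim v.1 v.2))
    (by
      have : Continuous fun v : StateSpace n m × StateSpace n m =>
          (Sum.elim v.1.ofLp v.2.ofLp : Idx n m ⊕ Idx n m → ℝ) := continuous_pi fun i => by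
        rcases i with i | i
        · simp only [Sum.elim_inl]
          fun_prop
        · simp only [Sum.elim_inr]
          fun_prop
      exact continuous_bil _ this this)
    (fun c v => by
      simp only [bil_symBlock, Prod.smul_fst, Prod.smul_snd, WithLp.ofLp_smul, bil_smul_left,
        bil_smul_right]
      ring)
    (fun v hv => by
      refine bil_self_pos hD.Y_pos fun h0 => hv (Prod.ext ?_ ?_)
      · ext i
        exact congrFun h0 (Sum.inl i)
      · ext i
        exact congrFun h0 (Sum.inr i))
  refine ⟨c₀, hc₀, CY + ∑ k, (h k * CS k + h k * (h k * (h k * (CR k * L ^ 2)))) + CQ, ?_,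
    fun t₀ ht₀ y hyc hy => ?_⟩
  · have : 0 ≤ ∑ k, (h k * CS k + h k * (h k * (h k * (CR k * L ^ 2)))) :=
      Finset.sum_nonneg fun k _ => by
        have := hh k
        have := hCS0 k
        have := hCR0 k
        positivity
    positivity
  set p : ℝ → StateSpace n m := velocity A B xbar D.gain τ t₀ y with hp
  have hpL : ∀ t δ, (∀ s ∈ Set.Icc (t - maxDelay h) t, ‖y s‖ ≤ δ) → ‖p t‖ ≤ L * δ :=
    fun t δ hw => norm_velocity_le hL0
      (fun t ht δ hw => hL τ y t δ (fun k => hτ k t ht) hw) ht₀ hh hw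
  have hpi : ∀ i a b, IntervalIntegrable (fun t => p t i) volume a b :=
    fun i a b => hy.velocity_apply_integrable i a b
  have hpp : ∀ k a b, IntervalIntegrable (fun t => bil (D.R k) (p t) (p t)) volume a b :=
    fun k a b => hy.bil_velocity_integrable hyc hpL (D.R k) a b
  have hzc : Continuous fun t => (y t).1.ofLp := by fun_prop
  have huc : Continuous fun t => (y t).2.ofLp := by fun_prop
  obtain ⟨W, W', hW0, hWC, hWi, hWd⟩ := hCQ t₀ ht₀ _ hzc
  have hρ0 : ∀ k t, 0 ≤ bil (D.R k) (p t) (p t) := fun k t =>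
    bil_self_nonneg (hD.R_pos k).posSemidef _
  refine ⟨fun t => lyap D h t₀ (fun t => (y t).1) (fun t => (y t).2) (fun t => p t) t + W t,
    fun t => lyapDeriv D h (fun t => (y t).1) (fun t => (y t).2) (fun t => p t) t + W' t,
    fun t ht => ?_, fun δ hδ => ?_, fun a b ha hab => ?_, fun t ht => ?_⟩
  · have h1 := hcoer (y t)
    have h2 := hW0 t (by linarith)
    have h3 : 0 ≤ ∑ k, ((∫ s in (t - h k)..t, bil (D.S k) (y s).1 (y s).1) +
        doubleWindow (fun s => bil (D.R k) (p s) (p s)) (h k) t₀ t) :=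
      Finset.sum_nonneg fun k _ => add_nonneg
        (intervalIntegral.integral_nonneg (by linarith [hh k]) fun s _ =>
          bil_self_nonneg (hD.S_pos k).posSemidef _)
        (doubleWindow_nonneg (hpp k) (hρ0 k) (hh k) _ _)
    simp only [lyap]
    linarith
  · have hz : ∀ s ∈ Set.Icc (t₀ - maxDelay h) (t₀ + maxDelay h), ∀ i, |(y s).1 i| ≤ δ :=
      fun s hs i => (PiLp.norm_apply_le (y s).1 i).trans ((norm_fst_le _).trans (hδ s hs))
    have hu : ∀ s ∈ Set.Icc (t₀ - maxDelay h) (t₀ + maxDelay h), ∀ i, |(y s).2 i| ≤ δ :=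
      fun s hs i => (PiLp.norm_apply_le (y s).2 i).trans ((norm_snd_le _).trans (hδ s hs))
    have ht1 : t₀ + maxDelay h ∈ Set.Icc (t₀ - maxDelay h) (t₀ + maxDelay h) :=
      ⟨by linarith, le_rfl⟩
    have hw : ∀ i, |(Sum.elim (y (t₀ + maxDelay h)).1.ofLp (y (t₀ + maxDelay h)).2.ofLp :
        Idx n m ⊕ Idx n m → ℝ) i| ≤ δ := by
      rintro (i | i)
      · exact hz _ ht1 i
      · exact hu _ ht1 i
    have h1 := (le_abs_self _).trans (hCY _ _ δ hw hw)
    have h2 := hWC (t₀ + maxDelay h) δ (by linarith) fun s hs i =>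
      hz s ⟨by linarith [hs.1], hs.2⟩ i
    have h3 : ∑ k, ((∫ s in (t₀ + maxDelay h - h k)..(t₀ + maxDelay h),
          bil (D.S k) (y s).1 (y s).1) +
        doubleWindow (fun s => bil (D.R k) (p s) (p s)) (h k) t₀ (t₀ + maxDelay h)) ≤
        ∑ k, (h k * CS k + h k * (h k * (h k * (CR k * L ^ 2)))) * δ ^ 2 := by
      refine Finset.sum_le_sum fun k _ => ?_
      have hk := le_maxDelay h k
      have g1 : ∫ s in (t₀ + maxDelay h - h k)..(t₀ + maxDelay h), bil (D.S k) (y s).1 (y s).1 ≤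
          ∫ _ in (t₀ + maxDelay h - h k)..(t₀ + maxDelay h), CS k * δ ^ 2 := by
        refine intervalIntegral.integral_mono_on (by linarith [hh k])
          ((continuous_bil _ hzc hzc).intervalIntegrable _ _) (by simp) fun s hs => ?_
        have hs' := hz s ⟨by linarith [hs.1], hs.2⟩
        exact (le_abs_self _).trans (hCS k _ _ _ hs' hs')
      rw [intervalIntegral.integral_const, smul_eq_mul] at g1
      have g2 := doubleWindow_le (hpp k) (C := CR k * (L * δ) ^ 2) (t := t₀ + maxDelay h) (hh k)
        (hρ0 k) (fun s hs => by
          have hs' : ∀ i, |p s i| ≤ L * δ := fun i => (PiLp.norm_apply_le (p s) i).trans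
            (hpL s δ fun r hr => hδ r ⟨by linarith [hs.1, hr.1], hr.2.trans hs.2⟩)
          exact (le_abs_self _).trans (hCR k _ _ _ hs' hs')) t₀
      linarith
    rw [← Finset.sum_mul] at h3
    simp only [lyap]
    linarith
  · obtain ⟨i1, e1⟩ := lyap_sub hYs h (t₀ := t₀) hzc huc hpi hpp hab
      (fun t ht i => hy.z_eq_velocity_apply (by linarith) (by linarith [ht.1]) i)
      (fun t ht i => hy.u_eq_integral_apply hh (by linarith) (by linarith [ht.1]) i)
    obtain ⟨i2, e2⟩ := hWi a b (by linarith) hab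
    refine ⟨i1.add i2, ?_⟩
    rw [intervalIntegral.integral_add i1 i2, ← e1]
    linarith
  · have ht0 : t₀ ≤ t := by linarith
    have hpt : p t = zRhs A B xbar D.gain τ y t :=
      Set.indicator_of_mem (show t ∈ Set.Ici t₀ from ht0) _
    have hr := fun k => hτ k t (ht₀.trans ht0)
    have h1 := lyapDeriv_le hD hpi hpp (z := fun t => (y t).1) (u := fun t => (y t).2)
      (t := t) (τ := fun k => τ k t)
      (g := calA A B (primalOf xbar (y t).1) *ᵥ (y t).1.ofLp) hr
      (fun k i => hy.z_eq_velocity_apply (by linarith [(hr k).2, le_maxDelay h k]) ht0 i)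
      (fun k i => hy.z_eq_velocity_apply (by linarith [le_maxDelay h k])
        (by linarith [(hr k).2, le_maxDelay h k]) i)
      (by
        rw [hpt, zRhs, Matrix.add_mulVec, Matrix.mulVec_sub, WithLp.ofLp_toLp]
        abel)
    have h2 := hWd t ht0
    rw [← hpt]
    linarith

end Functional

/-! ### Uniform asymptotic stability -/

section Stability

/-- Uniform asymptotic stability follows from the shift property, a uniform linear bound, and the
existence of a memory window with small values within a uniform time. -/
theorem uniformlyAsymptoticallyStable_of_linear_bound {E : Type} [NormedAddCommGroup E] {h : ℝ}
    {Sol : ℝ → (ℝ → E) → Prop} {C : ℝ} (hC : 0 < C)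
    (hshift : ∀ t₀ s y, Sol t₀ y → t₀ ≤ s → Sol s y)
    (hlin : ∀ t₀, 0 ≤ t₀ → ∀ y, Sol t₀ y → ∀ δ, 0 < δ → (∀ s ∈ Set.Icc (t₀ - h) t₀, ‖y s‖ ≤ δ) →
      ∀ t, t₀ ≤ t → ‖y t‖ ≤ C * δ)
    (hsmall : ∀ η > 0, ∃ T, 0 ≤ T ∧ ∀ t₀, 0 ≤ t₀ → ∀ y, Sol t₀ y →
      (∀ s ∈ Set.Icc (t₀ - h) t₀, ‖y s‖ ≤ 1) →
      ∃ s ∈ Set.Icc t₀ (t₀ + T), ∀ r ∈ Set.Icc (s - h) s, ‖y r‖ ≤ η) :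
    UniformlyAsymptoticallyStable h Sol := by
  refine ⟨fun ε hε => ⟨ε / (2 * C), by positivity, fun t₀ ht₀ y hy hw t ht => ?_⟩,
    1, one_pos, fun η hη => ?_⟩
  · have := hlin t₀ ht₀ y hy _ (by positivity) (fun s hs => (hw s hs).le) t ht
    have e : C * (ε / (2 * C)) = ε / 2 := by field_simp
    linarith
  · obtain ⟨T, hT, hT'⟩ := hsmall (η / (2 * C)) (by positivity)
    refine ⟨T, hT, fun t₀ ht₀ y hy hw t ht => ?_⟩
    obtain ⟨s, hs, hs'⟩ := hT' t₀ ht₀ y hy fun s hs => (hw s hs).le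
    have := hlin s (ht₀.trans hs.1) y (hshift _ _ _ hy hs.1) _ (by positivity) hs' t
      (hs.2.trans ht)
    have e : C * (η / (2 * C)) = η / 2 := by field_simp
    linarith

variable {N : ℕ} {n m : Fin N → ℕ} {A : Blocks n m}
  {B : ∀ i, EuclideanSpace ℝ (Fin (n i)) → Matrix (Fin (n i)) (Fin (n i)) ℝ}
  {xbar : Primal n} {h : Edge A → ℝ} {τ : Edge A → ℝ → ℝ}
  {f : ∀ i, EuclideanSpace ℝ (Fin (n i)) → ℝ} {μ ℓ : Fin N → ℝ} {D : Vars A} {ε : ℝ}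
  {d : Edge A → ℝ}

/-- Uniform stability, in quantitative form: up to `t₀ + h` the growth bound applies, afterwards the
functional does not increase and controls the state from above and below. -/
theorem exists_linear_bound (hμ : ∀ i, 0 < μ i)
    (hB : ∀ i, IsSecantFamily (f i) (μ i) (ℓ i) (xbar i) (B i))
    (hh : ∀ k, 0 ≤ h k) (hD : D.Feasible B ε h d)
    (hτ : ∀ k t, 0 ≤ t → τ k t ∈ Set.Icc 0 (h k)) (hQ : HasDelayEnergy D h d τ) :
    ∃ C, 1 ≤ C ∧ ∀ t₀, 0 ≤ t₀ → ∀ y, IsErrorSolution A B xbar D.gain h τ t₀ y → ∀ δ, 0 < δ →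
      (∀ s ∈ Set.Icc (t₀ - maxDelay h) t₀, ‖y s‖ ≤ δ) → ∀ t, t₀ ≤ t → ‖y t‖ ≤ C * δ := by
  obtain ⟨L, hL0, hL⟩ := exists_zRhs_bound A hμ hB D.gain hh
  obtain ⟨c₀, hc₀, C, hC0, hfun⟩ := exists_functional hμ hB hh hD hτ hQ
  have hm0 := maxDelay_nonneg hh
  set C₁ : ℝ := 2 * Real.exp ((L + 2) * maxDelay h) with hC₁
  have hC₁1 : 1 ≤ C₁ := by
    have : 1 ≤ Real.exp ((L + 2) * maxDelay h) := Real.one_le_exp (by positivity)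
    linarith
  have hCc : 0 ≤ C / c₀ := by positivity
  refine ⟨(1 + C / c₀) * C₁, one_le_mul_of_one_le_of_one_le (by linarith) hC₁1,
    fun t₀ ht₀ y₀ hy₀ δ hδ hw₀ => ?_⟩
  obtain ⟨y, hyc, hy, hyy⟩ := hy₀.exists_continuous ht₀ hh hτ
  have hw : ∀ s ∈ Set.Icc (t₀ - maxDelay h) t₀, ‖y s‖ ≤ δ := fun s hs => by
    rw [hyy s hs.1]
    exact hw₀ s hs
  intro t ht
  rw [← hyy t (by linarith)]
  have hgr : ∀ s, t₀ ≤ s → ‖y s‖ ≤ 2 * δ * Real.exp ((L + 2) * (s - t₀)) := fun s hs =>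
    norm_le_exp_of_memory_bound (p := velocity A B xbar D.gain τ t₀ y)
      (q := fun s => (y s).1 - (y s).2) hm0 (by linarith) hδ hyc
      (fun t ht c hc => by
        have hyt := hc t ⟨by linarith, le_rfl⟩
        have h1 := norm_velocity_le hL0
          (fun t ht δ hw => hL τ y t δ (fun k => hτ k t ht) hw) ht₀ hh hc
        have h2 := norm_sub_le (y t).1 (y t).2
        have h3 := norm_fst_le (y t)
        have h4 := norm_snd_le (y t)
        have h5 : 0 ≤ c := (norm_nonneg _).trans hyt
        have h6 : 0 ≤ L * c := mul_nonneg hL0 h5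
        constructor <;> linarith)
      (fun t ht => hy.z_eq_velocity le_rfl ht)
      (fun t ht => hy.u_eq t ht) hw hs
  have hearly : ∀ s ∈ Set.Icc (t₀ - maxDelay h) (t₀ + maxDelay h), ‖y s‖ ≤ C₁ * δ := by
    intro s hs
    by_cases hst : t₀ ≤ s
    · have : Real.exp ((L + 2) * (s - t₀)) ≤ Real.exp ((L + 2) * maxDelay h) := by
        gcongr
        linarith [hs.2]
      calc ‖y s‖ ≤ 2 * δ * Real.exp ((L + 2) * (s - t₀)) := hgr s hst
        _ ≤ 2 * δ * Real.exp ((L + 2) * maxDelay h) := by gcongr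
        _ = C₁ * δ := by rw [hC₁]; ring
    · have h1 := hw s ⟨hs.1, (not_le.mp hst).le⟩
      nlinarith
  have hC₁δ : 0 ≤ C₁ * δ := by positivity
  by_cases htt : t ≤ t₀ + maxDelay h
  · have h1 := hearly t ⟨by linarith, htt⟩
    have h2 : 0 ≤ C / c₀ * (C₁ * δ) := mul_nonneg hCc hC₁δ
    linarith
  · have htt' := (not_le.mp htt).le
    obtain ⟨V, V', hV1, hV2, hV3, hV4⟩ := hfun t₀ ht₀ y hyc hy
    have h1 := hV1 t htt'
    have h2 := hV2 _ hearly
    obtain ⟨-, h3⟩ := hV3 (t₀ + maxDelay h) t le_rfl htt'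
    have h4 : ∫ s in (t₀ + maxDelay h)..t, V' s ≤ 0 :=
      intervalIntegral_nonpos htt' fun s hs =>
        (hV4 s hs.1).trans (dissipation_nonpos hD _ _ _ _ _ _)
    have h5 : c₀ * ‖y t‖ ^ 2 ≤ C * (C₁ * δ) ^ 2 := by linarith
    have h6 : ‖y t‖ ^ 2 ≤ ((1 + C / c₀) * (C₁ * δ)) ^ 2 := by
      calc ‖y t‖ ^ 2 ≤ C / c₀ * (C₁ * δ) ^ 2 := by
            rw [div_mul_eq_mul_div, le_div_iff₀ hc₀]
            linarith
        _ ≤ (1 + C / c₀) ^ 2 * (C₁ * δ) ^ 2 := by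
            gcongr
            nlinarith
        _ = _ := by ring
    have h7 := abs_le_of_sq_le_sq h6 (by positivity)
    rw [abs_norm] at h7
    linarith

/-- Within a uniform time there is a memory window on which the solution is small: every window
on which it is not small costs the functional a fixed amount, since solutions have bounded
speed. -/
theorem exists_small_window (hf : ∀ i, ContDiff ℝ 2 (f i)) (hμ : ∀ i, 0 < μ i)
    (hB : ∀ i, IsSecantFamily (f i) (μ i) (ℓ i) (xbar i) (B i))
    (hh : ∀ k, 0 ≤ h k) (hD : D.Feasible B ε h d)
    (hτ : ∀ k t, 0 ≤ t → τ k t ∈ Set.Icc 0 (h k)) (hQ : HasDelayEnergy D h d τ) {η : ℝ}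
    (hη : 0 < η) :
    ∃ T, 0 ≤ T ∧ ∀ t₀, 0 ≤ t₀ → ∀ y, IsErrorSolution A B xbar D.gain h τ t₀ y →
      (∀ s ∈ Set.Icc (t₀ - maxDelay h) t₀, ‖y s‖ ≤ 1) →
      ∃ s ∈ Set.Icc t₀ (t₀ + T), ∀ r ∈ Set.Icc (s - maxDelay h) s, ‖y r‖ ≤ η := by
  obtain ⟨L, hL0, hL⟩ := exists_zRhs_bound A hμ hB D.gain hh
  obtain ⟨c₀, hc₀, C, hC0, hfun⟩ := exists_functional hμ hB hh hD hτ hQ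
  obtain ⟨C₁, hC₁, hlin⟩ := exists_linear_bound hμ hB hh hD hτ hQ
  have hm0 := maxDelay_nonneg hh
  -- A common bound for the state and for the speed.
  set M : ℝ := (L + 2) * C₁ with hM
  have hM0 : 0 < M := by positivity
  have hCM : C₁ ≤ M := by nlinarith
  obtain ⟨c, hc, hdis⟩ := exists_dissipation_le hf hB hD (half_pos hη) M
  -- After a time at which `‖y‖ > η`, looking back, `‖y‖ ≥ η / 2` for the time `w`.
  set w : ℝ := min 1 (η / (2 * M)) with hw
  have hw0 : 0 < w := by positivity
  have hw1 : w ≤ 1 := min_le_left _ _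
  have hwM : M * w ≤ η / 2 := by
    calc M * w ≤ M * (η / (2 * M)) := by gcongr; exact min_le_right _ _
      _ = η / 2 := by field_simp
  obtain ⟨J, hJ⟩ := exists_nat_gt (C * C₁ ^ 2 / (c * w))
  rw [div_lt_iff₀ (by positivity)] at hJ
  refine ⟨maxDelay h + J * (maxDelay h + 1), by positivity, fun t₀ ht₀ y₀ hy₀ hw₀ => ?_⟩
  obtain ⟨y, hyc, hy, hyy⟩ := hy₀.exists_continuous ht₀ hh hτ
  have hbd : ∀ s, t₀ - maxDelay h ≤ s → ‖y s‖ ≤ C₁ := fun s hs => by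
    rw [hyy s hs]
    by_cases hst : t₀ ≤ s
    · simpa using hlin t₀ ht₀ y₀ hy₀ 1 one_pos hw₀ s hst
    · exact (hw₀ s ⟨hs, (not_le.mp hst).le⟩).trans hC₁
  have hz : ∀ s, t₀ ≤ s → ‖zRhs A B xbar D.gain τ y s‖ ≤ M := fun s hs => by
    have := hL τ y s C₁ (fun k => hτ k s (ht₀.trans hs)) fun r hr => hbd r (by linarith [hr.1])
    nlinarith
  have hspeed : ∀ a b, t₀ ≤ a → a ≤ b → ‖y b - y a‖ ≤ M * (b - a) := by
    intro a b ha hab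
    rw [← abs_of_nonneg (sub_nonneg.mpr hab)]
    refine max_le ?_ ?_
    · change ‖(y b).1 - (y a).1‖ ≤ _
      rw [hy.z_eq_velocity ha (ha.trans hab), add_sub_cancel_left]
      refine intervalIntegral.norm_integral_le_of_norm_le_const fun s hs => ?_
      rw [Set.uIoc_of_le hab] at hs
      have hs0 : t₀ ≤ s := ha.trans hs.1.le
      rw [velocity, Set.indicator_of_mem (show s ∈ Set.Ici t₀ from hs0)]
      exact hz s hs0
    · change ‖(y b).2 - (y a).2‖ ≤ _
      rw [hy.u_eq_integral hh ha (ha.trans hab), add_sub_cancel_left]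
      refine intervalIntegral.norm_integral_le_of_norm_le_const fun s hs => ?_
      rw [Set.uIoc_of_le hab] at hs
      have h1 := hbd s (by linarith [hs.1])
      have h2 := norm_sub_le (y s).1 (y s).2
      have h3 := norm_fst_le (y s)
      have h4 := norm_snd_le (y s)
      nlinarith
  obtain ⟨V, V', hV1, hV2, hV3, hV4⟩ := hfun t₀ ht₀ y hyc hy
  set t₁ : ℝ := t₀ + maxDelay h with ht₁
  have hV' : ∀ s, t₁ ≤ s → V' s ≤ 0 := fun s hs =>
    (hV4 s hs).trans (dissipation_nonpos hD _ _ _ _ _ _)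
  have hVanti : ∀ a b, t₁ ≤ a → a ≤ b → V b ≤ V a := fun a b ha hab => by
    obtain ⟨-, h1⟩ := hV3 a b ha hab
    have := intervalIntegral_nonpos hab fun s hs =>
      hV' s (ha.trans hs.1)
    linarith
  have hdrop : ∀ x, t₁ ≤ x - w → η < ‖y x‖ → V x ≤ V (x - w) - c * w := by
    intro x hx hηx
    obtain ⟨hi, h1⟩ := hV3 (x - w) x hx (by linarith)
    have h2 : ∫ s in (x - w)..x, V' s ≤ ∫ _ in (x - w)..x, -c := by
      refine intervalIntegral.integral_mono_on (by linarith) hi (by simp) fun s hs => ?_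
      have hs1 : t₁ ≤ s := hx.trans hs.1
      have hs0 : t₀ ≤ s := by linarith
      refine (hV4 s hs1).trans (hdis (y s) _ (fun k => (y (s - h k)).1)
        (fun k => (y (s - τ k s)).1) ?_ ((hbd s (by linarith)).trans hCM) (hz s hs0) ?_ ?_)
      · have h3 := hspeed s x hs0 hs.2
        have h4 : M * (x - s) ≤ M * w := by
          gcongr
          linarith [hs.1]
        have h5 := norm_sub_norm_le (y x) (y s)
        linarith
      · intro k
        exact (norm_fst_le _).trans
          ((hbd _ (by linarith [le_maxDelay h k])).trans hCM)
      · intro k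
        exact (norm_fst_le _).trans
          ((hbd _ (by linarith [le_maxDelay h k, (hτ k s (ht₀.trans hs0)).2])).trans hCM)
    rw [intervalIntegral.integral_const, smul_eq_mul] at h2
    linarith
  by_contra! hcon
  have hind : ∀ j : ℕ, j ≤ J → V (t₁ + j * (maxDelay h + 1)) ≤ V t₁ - j * (c * w) := by
    intro j
    induction j with
    | zero => intro _; simp
    | succ j ih =>
      intro hj
      have hjJ : ((j + 1 : ℕ) : ℝ) * (maxDelay h + 1) ≤ J * (maxDelay h + 1) := by
        gcongr
      push_cast at hjJ ⊢
      have hj0 : 0 ≤ (j : ℝ) * (maxDelay h + 1) := by positivity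
      obtain ⟨x, hx, hηx⟩ := hcon (t₁ + (j + 1) * (maxDelay h + 1))
        ⟨by linarith, by linarith⟩
      have hx0 : t₁ + j * (maxDelay h + 1) ≤ x - w := by linarith [hx.1]
      rw [← hyy x (by linarith)] at hηx
      have h1 := hdrop x (by linarith) hηx
      have h2 := hVanti _ _ (by linarith) hx0
      have h3 := hVanti x _ (by linarith) hx.2
      have h4 := ih (by omega)
      linarith
  have h1 := hind J le_rfl
  have h2 := hV1 (t₁ + J * (maxDelay h + 1)) (by
    have : 0 ≤ (J : ℝ) * (maxDelay h + 1) := by positivity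
    linarith)
  have h3 := hV2 C₁ fun s hs => hbd s hs.1
  have h4 : 0 ≤ c₀ * ‖y (t₁ + J * (maxDelay h + 1))‖ ^ 2 := by positivity
  linarith

theorem errorUAS_of_feasible (hf : ∀ i, ContDiff ℝ 2 (f i)) (hμ : ∀ i, 0 < μ i)
    (hB : ∀ i, IsSecantFamily (f i) (μ i) (ℓ i) (xbar i) (B i))
    (hh : ∀ k, 0 ≤ h k) (hD : D.Feasible B ε h d)
    (hτ : ∀ k t, 0 ≤ t → τ k t ∈ Set.Icc 0 (h k)) (hQ : HasDelayEnergy D h d τ) :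
    ErrorUAS A B xbar D.gain h τ := by
  obtain ⟨C, hC, hlin⟩ := exists_linear_bound hμ hB hh hD hτ hQ
  exact uniformlyAsymptoticallyStable_of_linear_bound (by linarith)
    (fun t₀ s y hy hs => hy.shift hh hs) hlin
    fun η hη => exists_small_window hf hμ hB hh hD hτ hQ hη

end Stability

end DelayPDGD

end

theorem proposition1 {N : ℕ} (hN : 2 ≤ N) (n m : Fin N → ℕ) (hmn : ∑ i, m i < ∑ i, n i)
    (f : ∀ i, EuclideanSpace ℝ (Fin (n i)) → ℝ) (μ ℓ : Fin N → ℝ)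
    (hf : ∀ i, StronglyConvexSmooth (f i) (μ i) (ℓ i))
    (A : Blocks n m) (hA : FullRowRank A) (b : ∀ i, Fin (m i) → ℝ)
    (xbar : Primal n) (lbar : ∀ i, Fin (m i) → ℝ) (hKKT : IsKKT f A b xbar lbar)
    (B : ∀ i, EuclideanSpace ℝ (Fin (n i)) → Matrix (Fin (n i)) (Fin (n i)) ℝ)
    (hB : ∀ i, IsSecantFamily (f i) (μ i) (ℓ i) (xbar i) (B i))
    (h : Edge A → ℝ) (hh : ∀ k, 0 ≤ h k) (ε : ℝ) (hε : 0 < ε) :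
    -- slowly varying delays
    (∀ d : Edge A → ℝ, (∀ k, 0 ≤ d k ∧ d k < 1) →
      ∀ D : Vars A, (∀ k, (D.Q k).PosDef) → D.Feasible B ε h d →
        ∀ τ, SlowDelays h d τ → ErrorUAS A B xbar D.gain h τ) ∧
    -- fast-varying delays, feasibility with all `d_k = 1`
    (∀ D : Vars A, (∀ k, (D.Q k).PosDef) → D.Feasible B ε h (fun _ => 1) →
        ∀ τ, FastDelays h τ → ErrorUAS A B xbar D.gain h τ) ∧
    -- fast-varying delays, feasibility with all `Q_k = 0`
    (∀ d : Edge A → ℝ, ∀ D : Vars A, (∀ k, D.Q k = 0) → D.Feasible B ε h d →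
        ∀ τ, FastDelays h τ → ErrorUAS A B xbar D.gain h τ) := by
  have hf2 := fun i => (hf i).contDiff
  have hμ := fun i => (hf i).mu_pos
  refine ⟨fun d _ D hQ hD τ hτ => ?_, fun D hQ hD τ hτ => ?_, fun d D hQ hD τ hτ => ?_⟩
  · exact errorUAS_of_feasible hf2 hμ hB hh hD hτ.range
      (hτ.hasDelayEnergy (fun k => (hQ k).posSemidef) hh)
  · refine errorUAS_of_feasible hf2 hμ hB hh hD hτ.range
      (hasDelayEnergy_of_nonneg fun k x x' => ?_)
    simpa using bil_self_nonneg (hQ k).posSemidef x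
  · refine errorUAS_of_feasible hf2 hμ hB hh hD hτ.range
      (hasDelayEnergy_of_nonneg fun k x x' => ?_)
    simp [hQ k, bil]
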